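/- Let $I$ be a nonempty countable totally ordered index set (for instance $\mathbb N$ or $\mathbb Z$), let $(E_k)_{k\in I}$ be an increasing system of Fréchet spaces over $\mathbb K\in\{\mathbb R,\mathbb C\}$ with compatible continuous linear injective linking maps $E_k\hookrightarrow E_l$ ($k\le l$), so that $\operatorname{ind\,lim}_k E_k$ is an LF-space, and let $F$ be a Fréchet space over $\mathbb K$. Here an inductive limit carries the finest locally convex topology for which the canonical maps from the steps are continuous; $E\otimes_\iota F$ is $E\otimes F$ with the finest locally convex topology for which the canonical map $E\times F\to E\otimes F$ is separately continuous; and $E\,\widehat\otimes_\iota F$ is the (Hausdorff) completion of $E\otimes_\iota F$. Suppose that the inductive limit $\operatorname{ind\,lim}_k (E_k\,\widehat\otimes_\iota F)$, formed with the continuous extensions of the maps $E_k\otimes F\to E_l\otimes F$ as linking maps, is compactly regular, i.e. each compact subset of the limit is contained in a step and compact there, in the sense that it is the canonical image of a compact subset of some step $E_k\,\widehat\otimes_\iota F$. Then $$\operatorname{ind\,lim}_k (E_k\,\widehat\otimes_\iota F) = (\operatorname{ind\,lim}_k E_k)\,\widehat\otimes_\iota F ,$$ that is, there is a linear homeomorphism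 from the left-hand side onto the right-hand side which, for all $k\in I$, $x\in E_k$, $y\in F$, sends the class of $x\otimes y\in E_k\,\widehat\otimes_\iota F$ to $x\otimes y$, where on the right $x$ is regarded as an element of $\operatorname{ind\,lim}_k E_k$. -/

import Mathlib

open scoped TensorProduct Topology
open UniformSpace

noncomputable section

/-- A Fréchet space over `𝕜 = ℝ` or `ℂ`: a complete metrizable locally convex topological vector
space. Over `ℝ` and `ℂ`, `PolynormableSpace` says that the topology is generated by seminorms, i.e.
that it is a locally convex vector space topology. -/
class IsFrechetSpace (𝕜 E : Type*) [RCLike 𝕜] [AddCommGroup E] [Module 𝕜 E] [UniformSpace E] :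
    Prop where
  isUniformAddGroup : IsUniformAddGroup E
  locallyConvex : PolynormableSpace 𝕜 E
  metrizable : TopologicalSpace.MetrizableSpace E
  complete : CompleteSpace E

/-! ### Locally convex inductive limits -/

section Limit

variable {𝕜 : Type*} [RCLike 𝕜] {ι : Type*} [LinearOrder ι] {G : ι → Type*}
  [∀ k, AddCommGroup (G k)] [∀ k, Module 𝕜 (G k)] [∀ k, TopologicalSpace (G k)]

/-- The inductive limit `ind lim G k` of a system of topological vector spaces with continuous
linear linking maps `f k l : G k → G l` for `k ≤ l`; as a vector space it is the algebraic
direct limit. -/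
def LCLimit (f : ∀ k l, k ≤ l → G k →L[𝕜] G l) : Type _ :=
  Module.DirectLimit G fun k l h => (f k l h : G k →ₗ[𝕜] G l)

namespace LCLimit

variable (f : ∀ k l, k ≤ l → G k →L[𝕜] G l)

instance : AddCommGroup (LCLimit f) :=
  inferInstanceAs (AddCommGroup (Module.DirectLimit G fun k l h => (f k l h : G k →ₗ[𝕜] G l)))

instance : Module 𝕜 (LCLimit f) :=
  inferInstanceAs (Module 𝕜 (Module.DirectLimit G fun k l h => (f k l h : G k →ₗ[𝕜] G l)))

/-- The canonical linear map from a step to the limit. -/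
def ofLinear (k : ι) : G k →ₗ[𝕜] LCLimit f :=
  Module.DirectLimit.of 𝕜 ι G (fun k l h => (f k l h : G k →ₗ[𝕜] G l)) k

/-- The finest locally convex topology for which all canonical maps `G k → ind lim G k` are
continuous. (In Mathlib's order on topologies, finer means smaller.) -/
instance : TopologicalSpace (LCLimit f) :=
  sInf {t | PolynormableSpace 𝕜 (LCLimit f) (topology := t) ∧
    ∀ k, Continuous[inferInstance, t] (ofLinear f k)}

instance : PolynormableSpace 𝕜 (LCLimit f) := .sInf fun _ ht => ht.1

/-- The canonical map from a step to the limit. -/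
def of (k : ι) : G k →L[𝕜] LCLimit f :=
  ⟨ofLinear f k, continuous_sInf_rng.2 fun _ ht => ht.2 k⟩

end LCLimit

/-- The inductive limit of the system is compactly regular: each compact subset of the limit is
contained in a step and compact there, i.e. it is (the canonical image of) a compact subset of
some step. -/
def IsCompactlyRegular (f : ∀ k l, k ≤ l → G k →L[𝕜] G l) : Prop :=
  ∀ K : Set (LCLimit f), IsCompact K →
    ∃ (k : ι) (C : Set (G k)), IsCompact C ∧ LCLimit.of f k '' C = K

end Limit

/-- The system `f` presents an LF-space `ind lim E k`: the steps `E k` are Fréchet spaces, and the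
linking maps (the inclusions `E k ⊆ E l`, `k ≤ l`) are compatible, continuous, linear and
injective. -/
structure IsLFSystem {𝕜 : Type*} [RCLike 𝕜] {ι : Type*} [LinearOrder ι] {E : ι → Type*}
    [∀ k, AddCommGroup (E k)] [∀ k, Module 𝕜 (E k)] [∀ k, UniformSpace (E k)]
    (f : ∀ k l, k ≤ l → E k →L[𝕜] E l) : Prop where
  isFrechetSpace : ∀ k, IsFrechetSpace 𝕜 (E k)
  map_self : ∀ (k : ι) (x : E k), f k k le_rfl x = x
  map_map : ∀ (k l m : ι) (hkl : k ≤ l) (hlm : l ≤ m) (x : E k),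
    f l m hlm (f k l hkl x) = f k m (hkl.trans hlm) x
  injective : ∀ (k l : ι) (h : k ≤ l), Function.Injective (f k l h)

/-! ### The inductive tensor product and its completion -/

/-- The tensor product `E ⊗ F` with the inductive topology, `E ⊗_ι F`. -/
def InductiveTensor (𝕜 E F : Type*) [RCLike 𝕜] [AddCommGroup E] [Module 𝕜 E] [AddCommGroup F]
    [Module 𝕜 F] : Type _ :=
  E ⊗[𝕜] F

namespace InductiveTensor

section Basic

variable (𝕜 E F : Type*) [RCLike 𝕜] [AddCommGroup E] [Module 𝕜 E] [AddCommGroup F] [Module 𝕜 F]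

instance : AddCommGroup (InductiveTensor 𝕜 E F) := inferInstanceAs (AddCommGroup (E ⊗[𝕜] F))

instance : Module 𝕜 (InductiveTensor 𝕜 E F) := inferInstanceAs (Module 𝕜 (E ⊗[𝕜] F))

variable {E F}

/-- The elementary tensor `x ⊗ y`. -/
def tmul (x : E) (y : F) : InductiveTensor 𝕜 E F := x ⊗ₜ[𝕜] y

variable (E F) [TopologicalSpace E] [TopologicalSpace F]

/-- The inductive topology: the finest locally convex topology for which the canonical map
`E × F → E ⊗ F` is partially (i.e. separately) continuous. -/
instance : TopologicalSpace (InductiveTensor 𝕜 E F) :=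
  sInf {t | PolynormableSpace 𝕜 (InductiveTensor 𝕜 E F) (topology := t) ∧
    (∀ x : E, Continuous[inferInstance, t] fun y : F => tmul 𝕜 x y) ∧
    (∀ y : F, Continuous[inferInstance, t] fun x : E => tmul 𝕜 x y)}

instance : PolynormableSpace 𝕜 (InductiveTensor 𝕜 E F) := .sInf fun _ ht => ht.1

instance : IsTopologicalAddGroup (InductiveTensor 𝕜 E F) :=
  (PolynormableSpace.withSeminorms 𝕜 _).topologicalAddGroup

instance : ContinuousSMul 𝕜 (InductiveTensor 𝕜 E F) :=
  (PolynormableSpace.withSeminorms 𝕜 _).continuousSMul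

instance : UniformSpace (InductiveTensor 𝕜 E F) :=
  IsTopologicalAddGroup.rightUniformSpace _

instance : IsUniformAddGroup (InductiveTensor 𝕜 E F) :=
  isUniformAddGroup_of_addCommGroup

instance : UniformContinuousConstSMul 𝕜 (InductiveTensor 𝕜 E F) :=
  uniformContinuousConstSMul_of_continuousConstSMul _ _

end Basic

variable {𝕜 E E' : Type*} (F : Type*) [RCLike 𝕜] [AddCommGroup E] [Module 𝕜 E]
  [AddCommGroup E'] [Module 𝕜 E'] [AddCommGroup F] [Module 𝕜 F]
  [TopologicalSpace E] [TopologicalSpace E'] [TopologicalSpace F]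

/-- The continuous linear map `g ⊗ id : E ⊗_ι F → E' ⊗_ι F`. -/
def map (g : E →L[𝕜] E') : InductiveTensor 𝕜 E F →L[𝕜] InductiveTensor 𝕜 E' F where
  toLinearMap := LinearMap.rTensor F (g : E →ₗ[𝕜] E')
  cont := by
    refine continuous_sInf_rng.2 fun t ht => ?_
    rw [continuous_iff_le_induced]
    refine sInf_le ⟨?_, fun x => ?_, fun y => ?_⟩
    · exact @PolynormableSpace.induced _ _ _ _ _ _ _ _ _ _ _ _ t ht.1 _
    · exact continuous_induced_rng.2 (ht.2.1 (g x))
    · have h : Continuous[inferInstance, t] fun x : E' => tmul 𝕜 x y := ht.2.2 y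
      exact continuous_induced_rng.2 (h.comp g.continuous)

end InductiveTensor

/-- The completed inductive tensor product: the (Hausdorff) completion of `E ⊗_ι F`. -/
abbrev CompletedTensor (𝕜 E F : Type*) [RCLike 𝕜] [AddCommGroup E] [Module 𝕜 E]
    [AddCommGroup F] [Module 𝕜 F] [TopologicalSpace E] [TopologicalSpace F] : Type _ :=
  Completion (InductiveTensor 𝕜 E F)

namespace CompletedTensor

variable (𝕜 : Type*) {E E' : Type*} (F : Type*) [RCLike 𝕜] [AddCommGroup E] [Module 𝕜 E]
  [AddCommGroup E'] [Module 𝕜 E'] [AddCommGroup F] [Module 𝕜 F]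
  [TopologicalSpace E] [TopologicalSpace E'] [TopologicalSpace F]

variable {F} in
/-- The elementary tensor `x ⊗ y` in the completed tensor product. -/
def tmul (x : E) (y : F) : CompletedTensor 𝕜 E F :=
  (InductiveTensor.tmul 𝕜 x y : InductiveTensor 𝕜 E F)

variable {𝕜} in
/-- The continuous linear extension of `g ⊗ id` to the completions. -/
def map (g : E →L[𝕜] E') : CompletedTensor 𝕜 E F →L[𝕜] CompletedTensor 𝕜 E' F :=
  (InductiveTensor.map F g).completion

end CompletedTensor

/-- The linking maps of the system `E k ⊗̂_ι F` obtained from those of the system `E k`. -/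
def tensorSystem {𝕜 : Type*} [RCLike 𝕜] {ι : Type*} [LinearOrder ι] {E : ι → Type*}
    [∀ k, AddCommGroup (E k)] [∀ k, Module 𝕜 (E k)] [∀ k, TopologicalSpace (E k)]
    (f : ∀ k l, k ≤ l → E k →L[𝕜] E l)
    (F : Type*) [AddCommGroup F] [Module 𝕜 F] [TopologicalSpace F] :
    ∀ k l, k ≤ l → CompletedTensor 𝕜 (E k) F →L[𝕜] CompletedTensor 𝕜 (E l) F :=
  fun k l h => CompletedTensor.map F (f k l h)

end

/-
Compact regularity makes the limit `L` of the steps `E k ⊗̂ F` Hausdorff and complete. The canonical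
map `(ind lim E k) ⊗ F → L` is separately continuous, hence continuous, and so extends to the
completion. The extension is inverse to the canonical map `L → (ind lim E k) ⊗̂ F`, because both
composites fix the elementary tensors, which span dense subspaces.

The steps are first countable: since `F` is barrelled, separate continuity on `E k × F` gives
continuity at zero, so the convex hulls of the sets `U ⊗ V` form a basis. If a step had no zero
neighbourhood on which the topologies of all steps agree from some step on, one could choose null
sequences shrinking to zero whose union with zero is compact in `L` but in no step. On suitable
such neighbourhoods, which increase to `L`, the topology of `L` itself agrees with that of a step. A
Cauchy filter of `L`, once enlarged by the zero neighbourhoods of `L`, meets one of these sets, and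
there the completeness of the step provides a limit.
-/

noncomputable section

open Filter Set
open scoped Pointwise ComplexOrder

section AbsConvex

variable {𝕜 X Y : Type*} [RCLike 𝕜] [AddCommGroup X] [Module 𝕜 X] [AddCommGroup Y] [Module 𝕜 Y]

theorem absConvex_ball_zero (p : Seminorm 𝕜 X) (r : ℝ) : AbsConvex 𝕜 (p.ball 0 r) := by
  refine ⟨p.balanced_ball_zero r, fun x hx y hy a b ha hb hab => ?_⟩
  rw [p.mem_ball_zero] at hx hy ⊢
  have hnorm : ‖a‖ + ‖b‖ = 1 := by
    rw [← RCLike.ofReal_inj (K := 𝕜), RCLike.ofReal_add, RCLike.norm_of_nonneg' ha,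
      RCLike.norm_of_nonneg' hb, hab, RCLike.ofReal_one]
  calc p (a • x + b • y) ≤ ‖a‖ * p x + ‖b‖ * p y := by
        simpa only [map_smul_eq_mul] using map_add_le_add p (a • x) (b • y)
    _ ≤ (‖a‖ + ‖b‖) * max (p x) (p y) := by
        rw [add_mul]
        gcongr
        exacts [le_max_left _ _, le_max_right _ _]
    _ < r := by rw [hnorm, one_mul]; exact max_lt hx hy

theorem absConvex_image (T : X →ₗ[𝕜] Y) {A : Set X} (hA : AbsConvex 𝕜 A) :
    AbsConvex 𝕜 (T '' A) := by
  refine ⟨?_, hA.2.linear_image T⟩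
  rintro a ha _ ⟨_, ⟨x, hx, rfl⟩, rfl⟩
  exact ⟨a • x, hA.1.smul_mem ha hx, map_smul T a x⟩

theorem exists_seminorm_of_absConvex {A : Set X} (hA : AbsConvex 𝕜 A) (habs : Absorbent 𝕜 A) :
    ∃ p : Seminorm 𝕜 X, p.ball 0 1 ⊆ A ∧ A ⊆ p.closedBall 0 1 := by
  let _ : Module ℝ X := Module.compHom X (algebraMap ℝ 𝕜)
  have : IsScalarTower ℝ 𝕜 X := .of_algebraMap_smul fun _ _ => rfl
  have hconv : Convex ℝ A := hA.2.lift ℝ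
  have habs' : Absorbent ℝ A := fun x => (habs x).restrict_scalars <|
    tendsto_norm_atTop_iff_cobounded.1 <| by
      simpa only [norm_smul, norm_one, mul_one] using tendsto_norm_cobounded_atTop (E := ℝ)
  refine ⟨gaugeSeminorm hA.1 hconv habs', ?_, fun x hx => ?_⟩
  · rw [Seminorm.ball_zero_eq]
    exact setOfPred_gauge_lt_one_subset_self hconv habs.zero_mem habs'
  · rw [Seminorm.mem_closedBall_zero]
    exact gauge_le_one_of_mem hx

theorem exists_absConvex_mem_nhds_zero_subset [TopologicalSpace X] [PolynormableSpace 𝕜 X]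
    {V : Set X} (hV : V ∈ 𝓝 0) : ∃ A ∈ 𝓝 (0 : X), AbsConvex 𝕜 A ∧ A ⊆ V := by
  have hbasis := (PolynormableSpace.withSeminorms 𝕜 X).hasBasis_zero_ball
  obtain ⟨⟨s, r⟩, hr, hV⟩ := hbasis.mem_iff.1 hV
  exact ⟨_, hbasis.mem_of_mem (i := (s, r)) hr, absConvex_ball_zero _ _, hV⟩

/-- The locally convex topology defined by a single seminorm. -/
abbrev seminormTopology (p : Seminorm 𝕜 X) : TopologicalSpace X :=
  SeminormFamily.moduleFilterBasis (fun _ : Unit => p) |>.topology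

theorem polynormableSpace_seminormTopology (p : Seminorm 𝕜 X) :
    PolynormableSpace 𝕜 X (topology := seminormTopology p) :=
  letI := seminormTopology p
  WithSeminorms.toPolynormableSpace (p := fun _ : Unit => p) ⟨rfl⟩

theorem ball_mem_nhds_seminormTopology (p : Seminorm 𝕜 X) :
    p.ball 0 1 ∈ @nhds X (seminormTopology p) 0 := by
  let _ := seminormTopology p
  have h : WithSeminorms (fun _ : Unit => p) := ⟨rfl⟩
  have hp : Continuous p := h.continuous_seminorm ()
  rw [Seminorm.ball_zero_eq]
  exact (isOpen_lt hp continuous_const).mem_nhds (by simp)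

theorem continuous_seminormTopology (p : Seminorm 𝕜 Y) [TopologicalSpace X]
    [IsTopologicalAddGroup X] [ContinuousConstSMul 𝕜 X] (T : X →ₗ[𝕜] Y)
    (hT : T ⁻¹' p.closedBall 0 1 ∈ 𝓝 0) : Continuous[inferInstance, seminormTopology p] T :=
  letI := seminormTopology p
  WithSeminorms.continuous_of_continuous_comp (q := fun _ : Unit => p) ⟨rfl⟩ T fun _ =>
    Seminorm.continuous' (r := 1) <| by
      rwa [Seminorm.closedBall_comp, map_zero]

end AbsConvex

section FiniteSums

variable {𝕜 L : Type*} [RCLike 𝕜] [AddCommGroup L] [Module 𝕜 L]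

/-- The finite sums `∑ v i` with `v i ∈ V i`. Each one is encoded by a sequence `v` whose partial
sums are eventually constant, so that no terms have to be dropped when two sums are added. -/
def finiteSums (V : ℕ → Set L) : Set L :=
  {y | ∃ v : ℕ → L, (∀ i, v i ∈ V i) ∧ ∀ᶠ M in atTop, ∑ i ∈ Finset.range M, v i = y}

theorem finiteSums_mono {V W : ℕ → Set L} (h : ∀ i, V i ⊆ W i) : finiteSums V ⊆ finiteSums W :=
  fun _ ⟨v, hv, hsum⟩ => ⟨v, fun i => h i (hv i), hsum⟩

theorem subset_finiteSums {V : ℕ → Set L} (h0 : ∀ i, 0 ∈ V i) (n : ℕ) : V n ⊆ finiteSums V := by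
  refine fun y hy => ⟨Pi.single n y, fun i => ?_, eventually_atTop.2 ⟨n + 1, fun M hM => ?_⟩⟩
  · obtain rfl | hi := eq_or_ne i n
    · rwa [Pi.single_eq_same]
    · rw [Pi.single_eq_of_ne hi]
      exact h0 i
  · rw [Finset.sum_pi_single', if_pos (Finset.mem_range.2 hM)]

theorem absConvex_finiteSums {V : ℕ → Set L} (hV : ∀ i, AbsConvex 𝕜 (V i)) :
    AbsConvex 𝕜 (finiteSums V) := by
  refine ⟨?_, ?_⟩
  · rintro a ha _ ⟨_, ⟨v, hv, hsum⟩, rfl⟩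
    refine ⟨fun i => a • v i, fun i => (hV i).1.smul_mem ha (hv i), hsum.mono fun M hM => ?_⟩
    rw [← Finset.smul_sum, hM]
  · rintro _ ⟨v, hv, hvsum⟩ _ ⟨w, hw, hwsum⟩ a b ha hb hab
    refine ⟨fun i => a • v i + b • w i, fun i => (hV i).2 (hv i) (hw i) ha hb hab, ?_⟩
    filter_upwards [hvsum, hwsum] with M hvM hwM
    rw [Finset.sum_add_distrib, ← Finset.smul_sum, ← Finset.smul_sum, hvM, hwM]

end FiniteSums

section StepNhds

variable {𝕜 X L : Type*} [RCLike 𝕜] [AddCommGroup X] [Module 𝕜 X] [TopologicalSpace X]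
  [AddCommGroup L] [Module 𝕜 L] [TopologicalSpace L]

/-- The images under `g` of the zero neighbourhoods of `X` generate this filter on `L`. It carries
the topology of the step `X` of an inductive limit `L` over to `L`, and so allows us to compare the
topologies of different steps even when the canonical maps are not injective. -/
def stepNhds (g : X →L[𝕜] L) : Filter L :=
  map g (𝓝 0)

theorem stepNhds_le_nhds_zero (g : X →L[𝕜] L) : stepNhds g ≤ 𝓝 0 :=
  g.continuous.tendsto' 0 0 (map_zero g)

theorem range_mem_stepNhds (g : X →L[𝕜] L) : range g ∈ stepNhds g :=
  range_mem_map

theorem zero_mem_of_mem_stepNhds {g : X →L[𝕜] L} {V : Set L} (hV : V ∈ stepNhds g) : 0 ∈ V := by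
  have h : (0 : X) ∈ g ⁻¹' V := mem_of_mem_nhds hV
  rwa [mem_preimage, map_zero] at h

theorem tendsto_smul_stepNhds [ContinuousSMul 𝕜 X] {g : X →L[𝕜] L} {y : L} (hy : y ∈ range g) :
    Tendsto (fun c : 𝕜 => c • y) (𝓝 0) (stepNhds g) := by
  obtain ⟨x, rfl⟩ := hy
  have h : Tendsto (fun c : 𝕜 => c • x) (𝓝 0) (𝓝 0) :=
    (continuous_id.smul continuous_const).tendsto' 0 0 (zero_smul 𝕜 x)
  exact (tendsto_map.comp h).congr fun c => map_smul g c x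

theorem exists_absConvex_add_subset_of_mem_stepNhds [PolynormableSpace 𝕜 X] {g : X →L[𝕜] L}
    {V : Set L} (hV : V ∈ stepNhds g) :
    ∃ W ∈ stepNhds g, AbsConvex 𝕜 W ∧ W ⊆ range g ∧ W + W ⊆ V := by
  have := (PolynormableSpace.withSeminorms 𝕜 X).topologicalAddGroup
  obtain ⟨U, hU, hUV⟩ := exists_nhds_zero_half (mem_map.1 hV)
  obtain ⟨A, hA, hAc, hAU⟩ := exists_absConvex_mem_nhds_zero_subset (𝕜 := 𝕜) hU
  refine ⟨g '' A, image_mem_map hA, absConvex_image g.toLinearMap hAc, image_subset_range g A, ?_⟩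
  rintro _ ⟨_, ⟨x, hx, rfl⟩, _, ⟨y, hy, rfl⟩, rfl⟩
  simpa only [mem_preimage, map_add] using hUV x (hAU hx) y (hAU hy)

end StepNhds

section SeqLimit

variable {𝕜 L : Type*} [RCLike 𝕜] [AddCommGroup L] [Module 𝕜 L] [TopologicalSpace L] {X : ℕ → Type*}
  [∀ n, AddCommGroup (X n)] [∀ n, Module 𝕜 (X n)] [∀ n, TopologicalSpace (X n)]

/-- `L` is the locally convex inductive limit of a sequence of steps `X n` with canonical maps
`j n`. The linking maps are not recorded: `monotone` is all that is needed of them. -/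
structure IsSeqLimit (j : ∀ n, X n →L[𝕜] L) : Prop where
  monotone : Monotone fun n => stepNhds (j n)
  exists_mem_range : ∀ y, ∃ n, y ∈ range (j n)
  mem_nhds_zero : ∀ A, AbsConvex 𝕜 A → (∀ n, A ∈ stepNhds (j n)) → A ∈ 𝓝 0

namespace IsSeqLimit

variable {j : ∀ n, X n →L[𝕜] L}

theorem range_subset_range [∀ n, ContinuousSMul 𝕜 (X n)] (hj : IsSeqLimit j) {n m : ℕ}
    (h : n ≤ m) : range (j n) ⊆ range (j m) := by
  intro y hy
  have hrange : ∀ᶠ c : 𝕜 in 𝓝[≠] 0, c • y ∈ range (j m) :=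
    nhdsWithin_le_nhds <| (tendsto_smul_stepNhds hy).mono_right (hj.monotone h)
      (range_mem_stepNhds (j m))
  obtain ⟨c, hc, x, hx⟩ := (eventually_mem_nhdsWithin.and hrange).exists
  exact ⟨c⁻¹ • x, by rw [map_smul, hx, inv_smul_smul₀ hc]⟩

theorem shift [∀ n, ContinuousSMul 𝕜 (X n)] (hj : IsSeqLimit j) (m : ℕ) :
    IsSeqLimit fun n => j (m + n) where
  monotone _ _ h := hj.monotone (Nat.add_le_add_left h m)
  exists_mem_range y := by
    obtain ⟨n, hy⟩ := hj.exists_mem_range y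
    exact ⟨n, hj.range_subset_range (Nat.le_add_left n m) hy⟩
  mem_nhds_zero A hA h := hj.mem_nhds_zero A hA fun n => hj.monotone (Nat.le_add_left n m) (h n)

theorem finiteSums_mem_nhds_zero [∀ n, PolynormableSpace 𝕜 (X n)] (hj : IsSeqLimit j)
    {V : ℕ → Set L} (hV : ∀ i, V i ∈ stepNhds (j i)) : finiteSums V ∈ 𝓝 0 := by
  choose A hA hAc _ hAV using fun i => exists_absConvex_add_subset_of_mem_stepNhds (hV i)
  have h0 : ∀ i, 0 ∈ A i := fun i => zero_mem_of_mem_stepNhds (hA i)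
  have hAV' : ∀ i, A i ⊆ V i := fun i x hx => hAV i ⟨x, hx, 0, h0 i, add_zero x⟩
  refine mem_of_superset (hj.mem_nhds_zero _ (absConvex_finiteSums hAc) fun n => ?_)
    (finiteSums_mono hAV')
  exact mem_of_superset (hA n) (subset_finiteSums h0 n)

end IsSeqLimit

end SeqLimit

theorem exists_seq_of_forall_exists_succ {α : Type*} {P : ℕ → α → Prop} {R : ℕ → α → α → Prop}
    {a : α} (ha : P 0 a) (h : ∀ n a, P n a → ∃ b, P (n + 1) b ∧ R n a b) :
    ∃ u : ℕ → α, u 0 = a ∧ ∀ n, P n (u n) ∧ R n (u n) (u (n + 1)) := by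
  choose next hP hR using h
  let u : ∀ n, {a // P n a} := Nat.rec ⟨a, ha⟩ fun n b => ⟨next n b b.2, hP n b b.2⟩
  exact ⟨fun n => (u n).1, rfl, fun n => ⟨(u n).2, hR n (u n).1 (u n).2⟩⟩

section Chain

variable {𝕜 L : Type*} [RCLike 𝕜] [AddCommGroup L] [Module 𝕜 L]

theorem smul_mem_of_chain {W T : ℕ → Set L} {s : ℕ → L} {c : 𝕜} (hW : ∀ k, Balanced 𝕜 (W k))
    (hWT : ∀ k, (W (k + 1) + W (k + 1)) ∩ T k ⊆ W k) (hs : ∀ k, s (k + 1) - s k ∈ W (k + 1))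
    (hs0 : ∀ᶠ k in atTop, c • s k ∈ W k) (hc : ‖c‖ ≤ 1) (hT : ∀ k, c • s k ∈ T k) (k : ℕ) :
    c • s k ∈ W k := by
  obtain ⟨K, hK⟩ := eventually_atTop.1 hs0
  refine Nat.decreasingInduction' (m := k) (n := max k K) (fun l _ _ hl => hWT l ⟨?_, hT l⟩)
    (le_max_left k K) (hK _ (le_max_right k K))
  refine ⟨c • s (l + 1), hl, -(c • (s (l + 1) - s l)), ?_, ?_⟩
  · exact (hW _).neg_mem_iff.2 ((hW _).smul_mem hc (hs l))
  · simp only [smul_sub]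
    abel

-- Start with a multiple of `s` that lies in all `U k + U k` and double it `i` times: each time the
-- downward recursion of `smul_mem_of_chain` puts it into every `W k`, and `W k + W k ⊆ U (k + 1)`
-- absorbs the factor `2`.
theorem mem_of_chain {U W : ℕ → Set L} {s : ℕ → L} (hU : ∀ k, Balanced 𝕜 (U k))
    (hW : ∀ k, Balanced 𝕜 (W k)) (hW0 : ∀ k, 0 ∈ W k) (hWW : ∀ k, W k + W k ⊆ U (k + 1))
    (hWU : ∀ k, (W (k + 1) + W (k + 1)) ∩ (U k + U k) ⊆ W k)
    (hs : ∀ k, s (k + 1) - s k ∈ W k ∩ W (k + 1)) (hs0 : ∀ᶠ k in atTop, s k = 0)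
    (hs_zero : s 0 ∈ U 0 + U 0)
    {i : ℕ} (hsi : ∀ k, (2⁻¹ : 𝕜) ^ i • s k ∈ U k + U k) : s 0 ∈ W 0 := by
  have hnorm (i : ℕ) : ‖(2⁻¹ : 𝕜) ^ i‖ ≤ 1 := by
    rw [norm_pow]
    exact pow_le_one₀ (norm_nonneg _) (by rw [norm_inv, RCLike.norm_ofNat]; norm_num)
  have hmem (i : ℕ) : (∀ k, (2⁻¹ : 𝕜) ^ i • s k ∈ U k + U k) → ∀ k, (2⁻¹ : 𝕜) ^ i • s k ∈ W k :=
    smul_mem_of_chain hW hWU (fun k => (hs k).2)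
      (hs0.mono fun k hk => by rw [hk, smul_zero]; exact hW0 k) (hnorm i)
  induction i with
  | zero => simpa only [pow_zero, one_smul] using hmem 0 hsi 0
  | succ i ih =>
    refine ih fun k => ?_
    cases k with
    | zero => exact ((hU 0).add (hU 0)).smul_mem (hnorm i) hs_zero
    | succ k =>
      have hdouble : (2⁻¹ : 𝕜) ^ i • s k ∈ U (k + 1) := by
        refine hWW k ⟨_, hmem (i + 1) hsi k, _, hmem (i + 1) hsi k, ?_⟩
        simp only [← two_smul 𝕜, smul_smul, pow_succ']
        rw [mul_inv_cancel_left₀ two_ne_zero]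
      have hdiff : (2⁻¹ : 𝕜) ^ i • (s (k + 1) - s k) ∈ U (k + 1) :=
        (hU _).smul_mem (hnorm i) (hWW k ⟨_, (hs k).1, 0, hW0 k, add_zero _⟩)
      exact ⟨_, hdouble, _, hdiff, by simp only [← smul_add, add_sub_cancel]⟩

end Chain

section SeqLimit

variable {𝕜 L : Type*} [RCLike 𝕜] [AddCommGroup L] [Module 𝕜 L] [TopologicalSpace L] {X : ℕ → Type*}
  [∀ n, AddCommGroup (X n)] [∀ n, Module 𝕜 (X n)] [∀ n, TopologicalSpace (X n)]
  [∀ n, PolynormableSpace 𝕜 (X n)] {j : ∀ n, X n →L[𝕜] L}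

namespace IsSeqLimit

theorem exists_chain {U U' : ℕ → Set L} (hU' : ∀ k, U' k ∈ stepNhds (j k))
    (hU : ∀ k m, stepNhds (j m) ⊓ 𝓟 (U k) ≤ stepNhds (j (k + 1)))
    {V : Set L} (hV : V ∈ stepNhds (j 1)) :
    ∃ W : ℕ → Set L, W 0 ⊆ V ∧ ∀ k, W k ∈ stepNhds (j (k + 1)) ∧ AbsConvex 𝕜 (W k) ∧
      W k + W k ⊆ U' (k + 1) ∧ (W (k + 1) + W (k + 1)) ∩ U k ⊆ W k := by
  have hstart : ∃ W ∈ stepNhds (j 1), AbsConvex 𝕜 W ∧ W + W ⊆ U' 1 ∩ V := by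
    obtain ⟨W, hW, hWc, -, hWV⟩ :=
      exists_absConvex_add_subset_of_mem_stepNhds (inter_mem (hU' 1) hV)
    exact ⟨W, hW, hWc, hWV⟩
  obtain ⟨W₀, hW₀, hW₀c, hW₀V⟩ := hstart
  obtain ⟨W, rfl, hW⟩ := exists_seq_of_forall_exists_succ
    (P := fun k W => W ∈ stepNhds (j (k + 1)) ∧ AbsConvex 𝕜 W ∧ W + W ⊆ U' (k + 1))
    (R := fun k W W' => (W' + W') ∩ U k ⊆ W)
    ⟨hW₀, hW₀c, hW₀V.trans inter_subset_left⟩ fun k W ⟨hW, _, _⟩ => by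
      have hZ := hU k (k + 2) hW
      rw [mem_inf_principal] at hZ
      obtain ⟨W', hW', hW'c, -, hW'Z⟩ :=
        exists_absConvex_add_subset_of_mem_stepNhds (inter_mem (hU' (k + 2)) hZ)
      exact ⟨W', ⟨hW', hW'c, hW'Z.trans inter_subset_left⟩,
        fun x hx => (hW'Z hx.1).2 hx.2⟩
  refine ⟨W, fun x hx => (hW₀V ⟨x, hx, 0, zero_mem_of_mem_stepNhds hW₀, add_zero x⟩).2,
    fun k => ⟨(hW k).1.1, (hW k).1.2.1, (hW k).1.2.2, (hW k).2⟩⟩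

theorem eventually_forall_smul_mem {V : ℕ → Set L} (hV : ∀ k, V k ∈ stepNhds (j k)) {s : ℕ → L}
    (hs : ∀ k, s k ∈ range (j k)) (hs0 : ∀ᶠ k in atTop, s k = 0) :
    ∀ᶠ c : 𝕜 in 𝓝 0, ∀ k, c • s k ∈ V k := by
  have (n : ℕ) : ContinuousSMul 𝕜 (X n) := (PolynormableSpace.withSeminorms 𝕜 (X n)).continuousSMul
  obtain ⟨K, hK⟩ := eventually_atTop.1 hs0
  have hfin : ∀ᶠ c : 𝕜 in 𝓝 0, ∀ k ∈ Finset.range K, c • s k ∈ V k :=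
    (Finset.eventually_all _).2 fun k _ => tendsto_smul_stepNhds (hs k) (hV k)
  filter_upwards [hfin] with c hc k
  obtain hk | hk := lt_or_ge k K
  · exact hc k (Finset.mem_range.2 hk)
  · rw [hK k hk, smul_zero]
    exact zero_mem_of_mem_stepNhds (hV k)

theorem sub_mem_of_chain (hj : IsSeqLimit j) {U W : ℕ → Set L} (hU : ∀ k, U k ∈ stepNhds (j k))
    (hUb : ∀ k, Balanced 𝕜 (U k)) (hUj : ∀ k, U k ⊆ range (j k)) (hWb : ∀ k, Balanced 𝕜 (W k))
    (hW0 : ∀ k, 0 ∈ W k) (hWW : ∀ k, W k + W k ⊆ U (k + 1))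
    (hWU : ∀ k, (W (k + 1) + W (k + 1)) ∩ (U k + U k) ⊆ W k) {v : ℕ → L} {x : L}
    (hx : x ∈ U 0) (hv0 : v 0 ∈ U 0) (hv : ∀ k, v (k + 1) ∈ W k ∩ W (k + 1))
    (hvx : ∀ᶠ M in atTop, ∑ i ∈ Finset.range M, v i = x) : v 0 - x ∈ W 0 := by
  have (n : ℕ) : ContinuousSMul 𝕜 (X n) := (PolynormableSpace.withSeminorms 𝕜 (X n)).continuousSMul
  let s (k : ℕ) : L := ∑ i ∈ Finset.range (k + 1), v i - x
  have hs_zero : s 0 = v 0 - x := by simp only [s, zero_add, Finset.sum_range_one]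
  have hs_succ (k : ℕ) : s (k + 1) - s k = v (k + 1) := by
    simp only [s, Finset.sum_range_succ _ (k + 1), sub_sub_sub_cancel_right, add_sub_cancel_left]
  have hs0 : ∀ᶠ k in atTop, s k = 0 :=
    ((tendsto_add_atTop_nat 1).eventually hvx).mono fun k hk => sub_eq_zero.2 hk
  have hvU : ∀ k, v k ∈ U k
    | 0 => hv0
    | k + 1 => hWW k ⟨_, (hv k).1, 0, hW0 k, add_zero _⟩
  have hs_range (k : ℕ) : s k ∈ range (j k) := by
    refine (j k).range.sub_mem ((j k).range.sum_mem fun i hi => ?_) ?_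
    · exact hj.range_subset_range (Finset.mem_range_succ_iff.1 hi) (hUj i (hvU i))
    · exact hj.range_subset_range (Nat.zero_le k) (hUj 0 hx)
  have hUU (k : ℕ) : U k + U k ∈ stepNhds (j k) := mem_of_superset (hU k) fun y hy =>
    ⟨y, hy, 0, zero_mem_of_mem_stepNhds (hU k), add_zero y⟩
  have hpow : Tendsto (fun i => (2⁻¹ : 𝕜) ^ i) atTop (𝓝 0) :=
    tendsto_pow_atTop_nhds_zero_of_norm_lt_one (by rw [norm_inv, RCLike.norm_ofNat]; norm_num)
  obtain ⟨i, hi⟩ := (hpow.eventually (eventually_forall_smul_mem hUU hs_range hs0)).exists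
  rw [← hs_zero]
  refine mem_of_chain hUb hWb hW0 hWW hWU (fun k => by rw [hs_succ]; exact hv k) hs0 ?_ hi
  rw [hs_zero, sub_eq_add_neg]
  exact ⟨_, hv0, _, (hUb 0).neg_mem_iff.2 hx, rfl⟩

theorem exists_nhds_zero_inf_principal_le (hj : IsSeqLimit j) {U : ℕ → Set L}
    (hU : ∀ k, U k ∈ stepNhds (j k))
    (hUj : ∀ k m, stepNhds (j m) ⊓ 𝓟 (U k) ≤ stepNhds (j (k + 1))) :
    ∃ U' ∈ stepNhds (j 0), 𝓝 0 ⊓ 𝓟 U' ≤ stepNhds (j 1) := by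
  choose U' hU' hU'c hU'j hU'U using fun k => exists_absConvex_add_subset_of_mem_stepNhds (hU k)
  refine ⟨U' 0, hU' 0, fun V hV => mem_inf_principal.2 ?_⟩
  obtain ⟨V', hV', -, -, hV'V⟩ := exists_absConvex_add_subset_of_mem_stepNhds hV
  obtain ⟨W, hWV', hW⟩ := exists_chain hU' hUj hV'
  choose hWj hWc hWW hWU using hW
  have hW0 (k : ℕ) : 0 ∈ W k := zero_mem_of_mem_stepNhds (hWj k)
  let T : ℕ → Set L
    | 0 => U' 0 ∩ W 0
    | k + 1 => W k ∩ W (k + 1)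
  have hT : ∀ k, T k ∈ stepNhds (j k)
    | 0 => inter_mem (hU' 0) (hj.monotone zero_le_one (hWj 0))
    | k + 1 => inter_mem (hWj k) (hj.monotone (Nat.le_succ _) (hWj (k + 1)))
  filter_upwards [hj.finiteSums_mem_nhds_zero hT] with x hxT hxU
  obtain ⟨v, hv, hvx⟩ := hxT
  have hmem : v 0 - x ∈ W 0 :=
    hj.sub_mem_of_chain hU' (fun k => (hU'c k).1) hU'j (fun k => (hWc k).1) hW0 hWW
      (fun k => (inter_subset_inter_right _ (hU'U k)).trans (hWU k)) hxU (hv 0).1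
      (fun k => hv (k + 1)) hvx
  refine hV'V ⟨v 0, hWV' (hv 0).2, -(v 0 - x), hWV' ((hWc 0).1.neg_mem_iff.2 hmem), ?_⟩
  simp only [neg_sub, add_sub_cancel]

end IsSeqLimit

end SeqLimit

section SeqLimit

variable {𝕜 L : Type*} [RCLike 𝕜] [AddCommGroup L] [Module 𝕜 L] {X : ℕ → Type*}
  [∀ n, AddCommGroup (X n)] [∀ n, Module 𝕜 (X n)]

theorem inf_principal_add_self_le {X : Type*} [AddCommGroup X] [Module 𝕜 X] [TopologicalSpace X]
    [PolynormableSpace 𝕜 X] [TopologicalSpace L] [ContinuousConstSMul 𝕜 L] {g : X →L[𝕜] L}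
    {A : Set L} (hA : Convex 𝕜 A) (h : 𝓝 0 ⊓ 𝓟 A ≤ stepNhds g) :
    𝓝 0 ⊓ 𝓟 (A + A) ≤ stepNhds g := by
  intro V hV
  obtain ⟨W, hW, -, -, hWV⟩ := exists_absConvex_add_subset_of_mem_stepNhds hV
  have hhalf : Tendsto (fun x : L => (2⁻¹ : 𝕜) • x) (𝓝 0) (𝓝 0) :=
    (continuous_const_smul _).tendsto' 0 0 (smul_zero _)
  have hmem : ∀ᶠ x : L in 𝓝 0, (2⁻¹ : 𝕜) • x ∈ A → (2⁻¹ : 𝕜) • x ∈ W :=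
    hhalf.eventually (mem_inf_principal.1 (h hW))
  refine mem_inf_principal.2 (hmem.mono ?_)
  rintro _ hx ⟨a, ha, b, hb, rfl⟩
  have hxA : (2⁻¹ : 𝕜) • (a + b) ∈ A := by
    rw [smul_add]
    refine hA ha hb (by positivity) (by positivity) ?_
    rw [← two_mul, mul_inv_cancel₀ two_ne_zero]
  refine hWV ⟨_, hx hxA, _, hx hxA, ?_⟩
  simp only [← two_smul 𝕜, smul_smul]
  rw [mul_inv_cancel₀ two_ne_zero, one_smul]

theorem exists_absConvex_add_subset_inf_principal_le {X : Type*} [AddCommGroup X] [Module 𝕜 X]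
    [TopologicalSpace X] [PolynormableSpace 𝕜 X] [TopologicalSpace L] [PolynormableSpace 𝕜 L]
    {g : X →L[𝕜] L} {A U : Set L} (hA0 : 0 ∈ A) (hAc : AbsConvex 𝕜 A)
    (hA : 𝓝 0 ⊓ 𝓟 A ≤ stepNhds g) (hU : U ∈ stepNhds g) :
    ∃ A' ∈ stepNhds g, AbsConvex 𝕜 A' ∧ A + A ⊆ A' ∧ 𝓝 0 ⊓ 𝓟 A' ≤ 𝓟 U := by
  have := (PolynormableSpace.withSeminorms 𝕜 L).topologicalAddGroup
  have := (PolynormableSpace.withSeminorms 𝕜 L).continuousSMul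
  obtain ⟨U', hU', -, -, hU'U⟩ := exists_absConvex_add_subset_of_mem_stepNhds hU
  obtain ⟨O, hO, hOA⟩ := exists_nhds_zero_half
    (mem_inf_principal.1 (inf_principal_add_self_le hAc.2 hA hU'))
  obtain ⟨B, hB, hBc, -, hBU⟩ := exists_absConvex_add_subset_of_mem_stepNhds <|
    inter_mem hU' (stepNhds_le_nhds_zero g (neg_mem_nhds_zero L hO))
  have hB0 : 0 ∈ B := zero_mem_of_mem_stepNhds hB
  have hBU' : B ⊆ U' ∩ -O := fun b hb => hBU ⟨b, hb, 0, hB0, add_zero b⟩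
  refine ⟨A + A + B, mem_of_superset hB fun b hb => ?_,
    ⟨(hAc.1.add hAc.1).add hBc.1, (hAc.2.add hAc.2).add hBc.2⟩,
    fun x hx => ⟨x, hx, 0, hB0, add_zero x⟩, ?_⟩
  · exact ⟨0, ⟨0, hA0, 0, hA0, add_zero 0⟩, b, hb, zero_add b⟩
  · rw [le_principal_iff, mem_inf_principal]
    filter_upwards [hO] with x hxO
    rintro ⟨y, hy, b, hb, rfl⟩
    have hyU' : y ∈ U' := by
      have hyb := hOA (y + b) hxO (-b) (hBU' hb).2
      rw [add_neg_cancel_right] at hyb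
      exact hyb hy
    exact hU'U ⟨y, hyU', b, (hBU' hb).1, rfl⟩

theorem sum_range_mem_of_add_subset_succ {M : Type*} [AddCommMonoid M] {A : ℕ → Set M}
    (h0 : 0 ∈ A 0) (hA : ∀ n, A n + A n ⊆ A (n + 1)) {v : ℕ → M} (hv : ∀ i, v i ∈ A i) (n : ℕ) :
    ∑ i ∈ Finset.range n, v i ∈ A n := by
  induction n with
  | zero => rwa [Finset.sum_range_zero]
  | succ n ih =>
    rw [Finset.sum_range_succ]
    exact hA n ⟨_, ih, _, hv n, rfl⟩

theorem sum_range_mem_of_succ_add_subset {M : Type*} [AddCommMonoid M] {R : ℕ → Set M}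
    (h0 : ∀ n, 0 ∈ R n) (hR : ∀ n, R (n + 1) + R (n + 1) ⊆ R n) {v : ℕ → M}
    (hv : ∀ i, v i ∈ R (i + 1)) (n k : ℕ) : ∑ i ∈ Finset.range k, v (n + i) ∈ R n := by
  induction k generalizing n with
  | zero => rw [Finset.sum_range_zero]; exact h0 n
  | succ k ih =>
    rw [Finset.sum_range_succ']
    refine hR n ⟨_, ih (n + 1), _, hv n, ?_⟩
    simp only [add_zero, Nat.add_right_comm n 1, add_assoc]

theorem exists_nhds_zero_seq {G : Type*} [AddGroup G] [TopologicalSpace G]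
    [IsTopologicalAddGroup G] {W : ℕ → Set G} (hW : ∀ n, W n ∈ 𝓝 0) :
    ∃ R : ℕ → Set G, ∀ n, R n ∈ 𝓝 0 ∧ R n ⊆ W n ∧ R (n + 1) + R (n + 1) ⊆ R n := by
  obtain ⟨R, -, hR⟩ := exists_seq_of_forall_exists_succ
    (P := fun n R => R ∈ 𝓝 (0 : G) ∧ R ⊆ W n) (R := fun _ R R' => R' + R' ⊆ R)
    ⟨hW 0, Subset.rfl⟩ fun n R ⟨hR, _⟩ => by
      obtain ⟨R', hR', hR'R⟩ := exists_nhds_zero_half hR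
      refine ⟨R' ∩ W (n + 1), ⟨inter_mem hR' (hW _), inter_subset_right⟩, ?_⟩
      rintro _ ⟨x, hx, y, hy, rfl⟩
      exact hR'R x hx.1 y hy.1
  exact ⟨R, fun n => ⟨(hR n).1.1, (hR n).1.2, (hR n).2⟩⟩

namespace IsSeqLimit

variable [∀ n, TopologicalSpace (X n)]

theorem exists_absConvex_seq [∀ n, PolynormableSpace 𝕜 (X n)] [TopologicalSpace L]
    [PolynormableSpace 𝕜 L] {j : ∀ n, X n →L[𝕜] L}
    (h : ∀ n, ∃ U ∈ stepNhds (j n), 𝓝 0 ⊓ 𝓟 U ≤ stepNhds (j (n + 1))) :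
    ∃ A : ℕ → Set L, ∀ n, (A n ∈ stepNhds (j n) ∧ AbsConvex 𝕜 (A n) ∧
      𝓝 0 ⊓ 𝓟 (A n) ≤ stepNhds (j (n + 1))) ∧ A n + A n ⊆ A (n + 1) := by
  choose U hU hUj using h
  obtain ⟨A₀, hA₀, hA₀c, -, hA₀U⟩ := exists_absConvex_add_subset_of_mem_stepNhds (hU 0)
  have hA₀U' : A₀ ⊆ U 0 := fun x hx =>
    hA₀U ⟨x, hx, 0, zero_mem_of_mem_stepNhds hA₀, add_zero x⟩
  obtain ⟨A, -, hA⟩ := exists_seq_of_forall_exists_succ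
    (P := fun n A => A ∈ stepNhds (j n) ∧ AbsConvex 𝕜 A ∧ 𝓝 0 ⊓ 𝓟 A ≤ stepNhds (j (n + 1)))
    (R := fun _ A A' => A + A ⊆ A')
    ⟨hA₀, hA₀c, (inf_le_inf_left _ (principal_mono.2 hA₀U')).trans (hUj 0)⟩
    fun n A ⟨hA, hAc, hAj⟩ => by
      obtain ⟨A', hA', hA'c, hAA', hA'U⟩ := exists_absConvex_add_subset_inf_principal_le
        (zero_mem_of_mem_stepNhds hA) hAc hAj (hU (n + 1))
      exact ⟨A', ⟨hA', hA'c, (le_inf inf_le_left hA'U).trans (hUj (n + 1))⟩, hAA'⟩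
  exact ⟨A, hA⟩

theorem exists_mem_of_add_subset_succ [∀ n, ContinuousSMul 𝕜 (X n)] [TopologicalSpace L]
    {j : ∀ n, X n →L[𝕜] L} (hj : IsSeqLimit j) {A : ℕ → Set L} (hA : ∀ n, A n ∈ stepNhds (j n))
    (hAA : ∀ n, A n + A n ⊆ A (n + 1)) (y : L) :
    ∃ n, y ∈ A n := by
  have hdouble (i n : ℕ) (h : (2⁻¹ : 𝕜) ^ i • y ∈ A n) : y ∈ A (n + i) := by
    induction i generalizing n with
    | zero => rwa [pow_zero, one_smul] at h
    | succ i ih =>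
      rw [add_comm i, ← add_assoc]
      refine ih (n + 1) (hAA n ⟨_, h, _, h, ?_⟩)
      simp only [← two_smul 𝕜, smul_smul, pow_succ']
      rw [mul_inv_cancel_left₀ two_ne_zero]
  obtain ⟨n, hn⟩ := hj.exists_mem_range y
  have hpow : Tendsto (fun i => (2⁻¹ : 𝕜) ^ i) atTop (𝓝 0) :=
    tendsto_pow_atTop_nhds_zero_of_norm_lt_one (by rw [norm_inv, RCLike.norm_ofNat]; norm_num)
  obtain ⟨i, hi⟩ := (hpow.eventually (tendsto_smul_stepNhds hn (hA n))).exists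
  exact ⟨n + i, hdouble i n hi⟩

-- Otherwise `𝓕` avoids each `A n` by some zero neighbourhood. A member of `𝓕` whose differences are
-- finite sums `∑ v i` with `v i` small in `A i` then gives a contradiction: the head of such a sum
-- stays in some `A n`, and the tail in the neighbourhood belonging to that `n`.
theorem exists_neBot_inf_principal [UniformSpace L] [IsUniformAddGroup L]
    [∀ n, PolynormableSpace 𝕜 (X n)] {j : ∀ n, X n →L[𝕜] L} (hj : IsSeqLimit j) {A : ℕ → Set L}
    (hA : ∀ n, A n ∈ stepNhds (j n)) (hAA : ∀ n, A n + A n ⊆ A (n + 1))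
    {𝓕 : Filter L} (h𝓕 : Cauchy 𝓕) : ∃ n, ((𝓕 - 𝓝 0) ⊓ 𝓟 (A n)).NeBot := by
  have (n : ℕ) : ContinuousSMul 𝕜 (X n) := (PolynormableSpace.withSeminorms 𝕜 (X n)).continuousSMul
  by_contra! hbot
  have hdisj (n : ℕ) : ∃ F ∈ 𝓕, ∃ W ∈ 𝓝 (0 : L), F - W ⊆ (A n)ᶜ :=
    mem_sub.1 (inf_principal_eq_bot.1 (hbot n))
  choose F hF W hW hFW using hdisj
  obtain ⟨R, hR⟩ := exists_nhds_zero_seq fun n => hW (n + 1)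
  choose hR hRW hRR using hR
  have hV (i : ℕ) : A i ∩ R (i + 1) ∈ stepNhds (j i) :=
    inter_mem (hA i) (stepNhds_le_nhds_zero _ (hR _))
  have := h𝓕.1
  have hsub := ((IsUniformAddGroup.cauchy_iff_tendsto 𝓕).1 h𝓕).2
    (hj.finiteSums_mem_nhds_zero hV)
  obtain ⟨S, hS, hSsub⟩ := mem_prod_self_iff.1 hsub
  obtain ⟨z, hz⟩ := Filter.nonempty_of_mem hS
  obtain ⟨m, hzm⟩ := hj.exists_mem_of_add_subset_succ hA hAA z
  obtain ⟨y, hyS, hyF⟩ :=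
    Filter.nonempty_of_mem (inter_mem hS (hF (m + 1)))
  obtain ⟨v, hv, hvsum⟩ := hSsub (mk_mem_prod hyS hz)
  obtain ⟨k, hk⟩ := ((tendsto_add_atTop_nat m).eventually hvsum).exists
  have hhead : z + ∑ i ∈ Finset.range m, v i ∈ A (m + 1) :=
    hAA m ⟨z, hzm, _, sum_range_mem_of_add_subset_succ (zero_mem_of_mem_stepNhds (hA 0)) hAA
      (fun i => (hv i).1) m, rfl⟩
  have htail : ∑ i ∈ Finset.range k, v (m + i) ∈ W (m + 1) :=
    hRW m <| sum_range_mem_of_succ_add_subset (fun n => mem_of_mem_nhds (hR n)) hRR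
      (fun i => (hv i).2) m k
  refine hFW (m + 1) ⟨y, hyF, _, htail, ?_⟩ hhead
  rw [add_comm k, Finset.sum_range_add] at hk
  simp only [sub_eq_iff_eq_add]
  rw [add_assoc, hk, add_sub_cancel]

end IsSeqLimit

end SeqLimit

section Complete

theorem cauchy_iff_sub_le {G : Type*} [AddGroup G] [UniformSpace G] [IsUniformAddGroup G]
    {𝓕 : Filter G} : Cauchy 𝓕 ↔ 𝓕.NeBot ∧ 𝓕 - 𝓕 ≤ 𝓝 0 := by
  rw [IsUniformAddGroup.cauchy_iff_tendsto, ← map₂_sub, ← map_prod_eq_map₂, Tendsto]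

theorem cauchy_sub_nhds_zero {G : Type*} [AddCommGroup G] [UniformSpace G] [IsUniformAddGroup G]
    {𝓕 : Filter G} (h𝓕 : Cauchy 𝓕) : Cauchy (𝓕 - 𝓝 0) := by
  have := h𝓕.1
  refine cauchy_iff_sub_le.2 ⟨inferInstance, ?_⟩
  have hsub : 𝓝 (0 : G) - 𝓝 0 ≤ 𝓝 0 := by
    rw [← map₂_sub, ← map_prod_eq_map₂, ← nhds_prod_eq]
    exact continuous_sub.tendsto' _ _ (sub_zero 0)
  let _ := Filter.subtractionCommMonoid (α := G)
  calc 𝓕 - 𝓝 0 - (𝓕 - 𝓝 0) = 𝓕 - 𝓕 - (𝓝 0 - 𝓝 0) := sub_sub_sub_comm _ _ _ _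
    _ ≤ 𝓝 0 - 𝓝 0 := Filter.sub_le_sub (cauchy_iff_sub_le.1 h𝓕).2 hsub
    _ ≤ 𝓝 0 := hsub

variable {𝕜 X L : Type*} [RCLike 𝕜] [AddCommGroup X] [Module 𝕜 X] [UniformSpace X]
  [IsUniformAddGroup X] [FirstCountableTopology X] [CompleteSpace X]
  [AddCommGroup L] [Module 𝕜 L] [TopologicalSpace L] [IsTopologicalAddGroup L]

-- Passing to `X ⧸ ker g`, which is again complete because `X` is first countable, makes the map
-- injective, so that `𝓗` can be pulled back.
theorem exists_le_nhds_of_sub_le_stepNhds {g : X →L[𝕜] L} {𝓗 : Filter L} [𝓗.NeBot]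
    (h : 𝓗 - 𝓗 ≤ stepNhds g) : ∃ y, 𝓗 ≤ 𝓝 y := by
  let φ : X →+ L := g.toLinearMap.toAddMonoidHom
  let _ : UniformSpace (X ⧸ φ.ker) := IsTopologicalAddGroup.rightUniformSpace _
  have : IsUniformAddGroup (X ⧸ φ.ker) := isUniformAddGroup_of_addCommGroup
  let ψ : X ⧸ φ.ker →+ L := QuotientAddGroup.kerLift φ
  have hψ : Continuous ψ := continuous_quot_lift _ g.continuous
  have hψg : map ψ (𝓝 0) = stepNhds g := by
    rw [← QuotientAddGroup.mk_zero, QuotientAddGroup.nhds_eq, map_map]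
    rfl
  obtain ⟨S, hS, S', hS', hSS'⟩ := mem_sub.1 (h (hψg ▸ range_mem_map : range ψ ∈ stepNhds g))
  obtain ⟨z, hz⟩ := Filter.nonempty_of_mem hS'
  have hrange : range (fun q => z + ψ q) ∈ 𝓗 := mem_of_superset hS fun y hy => by
    obtain ⟨q, hq⟩ := hSS' ⟨y, hy, z, hz, rfl⟩
    exact ⟨q, by simp only [hq, add_sub_cancel]⟩
  let 𝓠 : Filter (X ⧸ φ.ker) := comap (fun q => z + ψ q) 𝓗
  have h𝓠 : map (fun q => z + ψ q) 𝓠 = 𝓗 := map_comap_of_mem hrange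
  have h𝓠sub : map ψ (𝓠 - 𝓠) = 𝓗 - 𝓗 := by
    rw [← map₂_sub, map_map₂_distrib (m' := fun x y : L => x - y)
      (n₁ := fun q => z + ψ q) (n₂ := fun q => z + ψ q), h𝓠, map₂_sub]
    intro p q
    rw [map_sub, add_sub_add_left_eq_sub]
  have hcauchy : Cauchy 𝓠 := cauchy_iff_sub_le.2
    ⟨comap_neBot_iff_compl_range.2 fun hc => by
      simpa using inter_mem hrange hc,
    (map_le_map_iff (QuotientAddGroup.kerLift_injective φ)).1 (by
      rwa [h𝓠sub, hψg])⟩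
  obtain ⟨q, hq⟩ := CompleteSpace.complete hcauchy
  refine ⟨z + ψ q, ?_⟩
  rw [← h𝓠]
  exact (map_mono hq).trans (continuous_const.add hψ).continuousAt

end Complete

section SeqLimit

variable {𝕜 L : Type*} [RCLike 𝕜] [AddCommGroup L] [Module 𝕜 L] [UniformSpace L]
  [IsUniformAddGroup L] [PolynormableSpace 𝕜 L] {X : ℕ → Type*} [∀ n, AddCommGroup (X n)]
  [∀ n, Module 𝕜 (X n)] [∀ n, UniformSpace (X n)] [∀ n, IsUniformAddGroup (X n)]
  [∀ n, PolynormableSpace 𝕜 (X n)] [∀ n, FirstCountableTopology (X n)]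
  [∀ n, CompleteSpace (X n)] {j : ∀ n, X n →L[𝕜] L}

theorem IsSeqLimit.completeSpace (hj : IsSeqLimit j)
    (h : ∀ n, ∃ U ∈ stepNhds (j n), ∀ m, stepNhds (j m) ⊓ 𝓟 U ≤ stepNhds (j (n + 1))) :
    CompleteSpace L where
  complete {𝓕} h𝓕 := by
    have (n : ℕ) : ContinuousSMul 𝕜 (X n) :=
      (PolynormableSpace.withSeminorms 𝕜 (X n)).continuousSMul
    choose U hU hUj using h
    obtain ⟨A, hA⟩ := exists_absConvex_seq fun n =>
      (hj.shift n).exists_nhds_zero_inf_principal_le (fun k => hU (n + k))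
        fun k m => hUj (n + k) (n + m)
    choose hA hAA using hA
    obtain ⟨n, hn⟩ := hj.exists_neBot_inf_principal (fun n => (hA n).1) hAA h𝓕
    have hcauchy : Cauchy (𝓕 - 𝓝 0) := cauchy_sub_nhds_zero h𝓕
    have hsub : ((𝓕 - 𝓝 0) ⊓ 𝓟 (A n)) - ((𝓕 - 𝓝 0) ⊓ 𝓟 (A n)) ≤ stepNhds (j (n + 2)) := by
      refine le_trans (le_inf ?_ (le_principal_iff.2 ?_)) (hA (n + 1)).2.2
      · exact (Filter.sub_le_sub inf_le_left inf_le_left).trans (cauchy_iff_sub_le.1 hcauchy).2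
      · refine mem_of_superset (sub_mem_sub (mem_inf_of_right (mem_principal_self _))
          (mem_inf_of_right (mem_principal_self _))) ?_
        rintro _ ⟨x, hx, y, hy, rfl⟩
        exact hAA n ⟨x, hx, -y, (hA n).2.1.1.neg_mem_iff.2 hy, (sub_eq_add_neg x y).symm⟩
    obtain ⟨y, hy⟩ := exists_le_nhds_of_sub_le_stepNhds hsub
    have hcluster : ClusterPt y (𝓕 - 𝓝 0) := hn.mono (le_inf hy inf_le_left)
    refine ⟨y, le_trans ?_ (le_nhds_of_cauchy_adhp hcauchy hcluster)⟩
    intro S hS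
    obtain ⟨F, hF, W, hW, hFW⟩ := mem_sub.1 hS
    exact mem_of_superset hF fun x hx => hFW ⟨x, hx, 0, mem_of_mem_nhds hW, sub_zero x⟩

end SeqLimit

section GeneralTopology

theorem not_isGδ_setOf_not_irrational : ¬ IsGδ {t : ℝ | ¬ Irrational t} := fun h => by
  have hdense : Dense {t : ℝ | ¬ Irrational t} := by
    simpa only [Irrational, not_not] using! Rat.denseRange_cast (𝕜 := ℝ)
  obtain ⟨t, ht, ht'⟩ :=
    (hdense.inter_of_Gδ h IsGδ.setOfPred_irrational dense_irrational).nonempty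
  exact ht ht'

theorem isCompact_of_subset_closure_singleton {Y : Type*} [TopologicalSpace Y] [R1Space Y]
    {S : Set Y} {a : Y} (hS : S ⊆ closure {a}) : IsCompact S := by
  have ha : ∀ y ∈ S, SeparationQuotient.mk y = SeparationQuotient.mk a := fun y hy =>
    SeparationQuotient.mk_eq_mk.2 (specializes_iff_mem_closure.2 (hS hy)).inseparable.symm
  rw [SeparationQuotient.isInducing_mk.isCompact_iff]
  refine Set.Subsingleton.isCompact ?_
  rintro _ ⟨y, hy, rfl⟩ _ ⟨z, hz, rfl⟩
  rw [ha y hy, ha z hz]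

end GeneralTopology

namespace LCLimit

variable {𝕜 : Type*} [RCLike 𝕜] {ι : Type*} [LinearOrder ι] {G : ι → Type*}
  [∀ k, AddCommGroup (G k)] [∀ k, Module 𝕜 (G k)] [∀ k, TopologicalSpace (G k)]
  (f : ∀ k l, k ≤ l → G k →L[𝕜] G l)

instance : IsTopologicalAddGroup (LCLimit f) :=
  (PolynormableSpace.withSeminorms 𝕜 _).topologicalAddGroup

instance : ContinuousSMul 𝕜 (LCLimit f) :=
  (PolynormableSpace.withSeminorms 𝕜 _).continuousSMul

instance : UniformSpace (LCLimit f) :=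
  IsTopologicalAddGroup.rightUniformSpace _

instance : IsUniformAddGroup (LCLimit f) :=
  isUniformAddGroup_of_addCommGroup

instance : UniformContinuousConstSMul 𝕜 (LCLimit f) :=
  uniformContinuousConstSMul_of_continuousConstSMul _ _

theorem of_map {k l : ι} (h : k ≤ l) (x : G k) : of f l (f k l h x) = of f k x :=
  Module.DirectLimit.of_f (f := fun k l h => (f k l h : G k →ₗ[𝕜] G l))

theorem exists_of [Nonempty ι] (y : LCLimit f) : ∃ k x, of f k x = y :=
  Module.DirectLimit.exists_of y

theorem stepNhds_of_mono : Monotone fun k => stepNhds (of f k) := by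
  intro k l h
  have hcomp : (of f k : G k → LCLimit f) = of f l ∘ f k l h := funext fun x => (of_map f h x).symm
  change map (of f k) (𝓝 0) ≤ map (of f l) (𝓝 0)
  rw [hcomp, ← map_map]
  exact map_mono ((f k l h).continuous.tendsto' 0 0 (map_zero _))

variable {f}

theorem exists_map_eq_map [DirectedSystem G fun k l h => f k l h] {k : ι} {x y : G k}
    (h : of f k x = of f k y) : ∃ l, ∃ hkl : k ≤ l, f k l hkl x = f k l hkl y := by
  have : DirectedSystem G fun k l h => (f k l h : G k →ₗ[𝕜] G l) :=
    ‹DirectedSystem G fun k l h => f k l h›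
  exact Module.DirectLimit.exists_eq_of_of_eq (f := fun k l h => (f k l h : G k →ₗ[𝕜] G l)) h

theorem continuous_linearMap {Y : Type*} [AddCommGroup Y] [Module 𝕜 Y] [TopologicalSpace Y]
    [PolynormableSpace 𝕜 Y] (T : LCLimit f →ₗ[𝕜] Y) (h : ∀ k, Continuous fun x => T (of f k x)) :
    Continuous T :=
  continuous_iff_le_induced.2 <|
    sInf_le ⟨PolynormableSpace.induced T, fun k => continuous_induced_rng.2 (h k)⟩

section Steps

variable [∀ k, IsTopologicalAddGroup (G k)] [∀ k, ContinuousSMul 𝕜 (G k)] [Nonempty ι]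

theorem mem_nhds_zero {A : Set (LCLimit f)} (hA : AbsConvex 𝕜 A)
    (h : ∀ k, A ∈ stepNhds (of f k)) : A ∈ 𝓝 0 := by
  have habs : Absorbent 𝕜 A := absorbent_iff_eventually_nhdsNE_zero.2 fun y => by
    obtain ⟨k, x, rfl⟩ := exists_of f y
    exact nhdsWithin_le_nhds (tendsto_smul_stepNhds (mem_range_self x) (h k))
  obtain ⟨p, hpA, hAp⟩ := exists_seminorm_of_absConvex hA habs
  have hle : (inferInstance : TopologicalSpace (LCLimit f)) ≤ seminormTopology p :=
    sInf_le ⟨polynormableSpace_seminormTopology p, fun k =>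
      continuous_seminormTopology p (ofLinear f k) (mem_of_superset (h k) (preimage_mono hAp))⟩
  exact mem_of_superset (nhds_mono hle (ball_mem_nhds_seminormTopology p)) hpA

theorem isSeqLimit {φ : ℕ → ι} (hφ : Monotone φ) (hcof : ∀ k, ∃ n, k ≤ φ n) :
    IsSeqLimit fun n => of f (φ n) where
  monotone := (stepNhds_of_mono f).comp hφ
  exists_mem_range y := by
    obtain ⟨k, x, rfl⟩ := exists_of f y
    obtain ⟨n, hn⟩ := hcof k
    exact ⟨n, f k (φ n) hn x, of_map f hn x⟩
  mem_nhds_zero A hA h := mem_nhds_zero hA fun k =>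
    let ⟨n, hn⟩ := hcof k
    stepNhds_of_mono f hn (h n)

end Steps

section Hausdorff

theorem exists_compact_of_le (hreg : IsCompactlyRegular f) {K : Set (LCLimit f)} (hK : IsCompact K)
    (n : ι) : ∃ k ≥ n, ∃ C : Set (G k), IsCompact C ∧ of f k '' C = K := by
  obtain ⟨k, C, hC, rfl⟩ := hreg K hK
  refine ⟨max k n, le_max_right _ _, _, hC.image (f k _ (le_max_left k n)).continuous, ?_⟩
  simp only [image_image, of_map]

theorem exists_map_mem_image_iff [DirectedSystem G fun k l h => f k l h] {k : ι} {x : G k}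
    {C : Set (G k)} :
    of f k x ∈ of f k '' C ↔ ∃ l, ∃ h : k ≤ l, f k l h x ∈ f k l h '' C := by
  constructor
  · rintro ⟨z, hz, hzx⟩
    obtain ⟨l, hl, hzx⟩ := exists_map_eq_map hzx
    exact ⟨l, hl, z, hz, hzx⟩
  · rintro ⟨l, hl, z, hz, hzx⟩
    exact ⟨z, hz, by rw [← of_map f hl z, hzx, of_map]⟩

variable [∀ k, T2Space (G k)] [∀ k, ContinuousSMul 𝕜 (G k)] [Countable ι]

theorem isGδ_setOf_smul_notMem [DirectedSystem G fun k l h => f k l h] {k : ι} {C : Set (G k)}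
    (hC : IsCompact C) (x : G k) : IsGδ {t : ℝ | (t : 𝕜) • of f k x ∉ of f k '' C} := by
  have heq : {t : ℝ | (t : 𝕜) • of f k x ∉ of f k '' C} =
      ⋂ l : Ici k, {t : ℝ | (t : 𝕜) • f k l l.2 x ∉ f k l l.2 '' C} := by
    ext t
    simp only [← map_smul, mem_ofPred_eq, exists_map_mem_image_iff, not_exists, mem_iInter,
      Subtype.forall]
    rfl
  rw [heq]
  refine .iInter_of_isOpen fun l => ?_
  have hcont : Continuous fun t : ℝ => (t : 𝕜) • f k l l.2 x :=
    RCLike.continuous_ofReal.smul continuous_const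
  exact ((hC.image (f k l l.2).continuous).isClosed.preimage hcont).isOpen_compl

-- If `x ≠ 0` were in the closure of `0`, then so would be the compact set of its irrational
-- multiples. As the image of a compact subset of a step this set would be a countable union of
-- sets `C l` with `{t : t • x ∈ C l}` closed.
theorem t2Space_of_isCompactlyRegular [DirectedSystem G fun k l h => f k l h] [Nonempty ι]
    (hreg : IsCompactlyRegular f) : T2Space (LCLimit f) := by
  suffices h : closure ({0} : Set (LCLimit f)) ⊆ {0} by
    have := IsTopologicalAddGroup.t1Space (LCLimit f) (isClosed_of_closure_subset h)
    infer_instance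
  intro y hy
  by_contra hy0
  obtain ⟨n, x, rfl⟩ := exists_of f y
  set S : Set (LCLimit f) := (fun t : ℝ => (t : 𝕜) • of f n x) '' {t | Irrational t} with hS
  have hS0 : S ⊆ closure {0} := by
    rintro _ ⟨t, -, rfl⟩
    simpa only [image_singleton, smul_zero] using image_closure_subset_closure_image
      (continuous_const_smul (t : 𝕜)) (mem_image_of_mem _ hy)
  obtain ⟨k, hk, C, hC, hCS⟩ :=
    exists_compact_of_le hreg (isCompact_of_subset_closure_singleton hS0) n
  refine not_isGδ_setOf_not_irrational ?_
  have hinj : Function.Injective fun t : ℝ => (t : 𝕜) • of f n x :=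
    (smul_left_injective 𝕜 hy0).comp RCLike.ofReal_injective
  simpa only [hCS, of_map, hS, hinj.mem_set_image, mem_ofPred_eq] using
    isGδ_setOf_smul_notMem (f := f) hC (f n k hk x)

end Hausdorff

end LCLimit

section Sequences

theorem exists_monotone_cofinal_seq {ι : Type*} [LinearOrder ι] [Countable ι] [Nonempty ι]
    (M : ι → ι) :
    ∃ φ : ℕ → ι, Monotone φ ∧ (∀ n, M (φ n) ≤ φ (n + 1)) ∧ ∀ k, ∃ n, k ≤ φ n := by
  obtain ⟨e, he⟩ := exists_surjective_nat ι
  let φ : ℕ → ι := fun n => Nat.rec (e 0) (fun n k => max k (max (M k) (e n))) n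
  refine ⟨φ, monotone_nat_of_le_succ fun n => le_max_left _ _, fun n =>
    (le_max_left _ _).trans (le_max_right _ _), fun k => ?_⟩
  obtain ⟨n, rfl⟩ := he k
  exact ⟨n + 1, (le_max_right _ _).trans (le_max_right _ _)⟩

theorem exists_seq_tendsto_not_tendsto {α : Type*} {l m : Filter α} [l.IsCountablyGenerated]
    {U : Set α} (h : ¬ l ⊓ 𝓟 U ≤ m) :
    ∃ y : ℕ → α, Tendsto y atTop l ∧ (∀ i, y i ∈ U) ∧ ¬ Tendsto y atTop m := by
  obtain ⟨V, hV, hVU⟩ := Filter.not_le.1 h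
  have hfreq : ∃ᶠ y in l, y ∈ U ∧ y ∉ V := fun hev =>
    hVU (mem_inf_principal.2 (hev.mono fun y hy hyU => by_contra fun hyV => hy ⟨hyU, hyV⟩))
  obtain ⟨y, hyl, hyUV⟩ := exists_seq_forall_of_frequently hfreq
  refine ⟨y, hyl, fun i => (hyUV i).1, fun hy => ?_⟩
  obtain ⟨i, hi⟩ := (hy.eventually_mem hV).exists
  exact (hyUV i).2 hi

theorem tendsto_uncurry_cofinite {α β γ : Type*} {l : Filter γ} {y : α → β → γ}
    (hy : ∀ a, Tendsto (y a) cofinite l) (h : ∀ W ∈ l, ∀ᶠ a in cofinite, ∀ b, y a b ∈ W) :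
    Tendsto (Function.uncurry y) cofinite l := by
  intro W hW
  have hfin : (⋃ a ∈ {a | ¬ ∀ b, y a b ∈ W}, Prod.mk a '' {b | y a b ∉ W}).Finite :=
    (eventually_cofinite.1 (h W hW)).biUnion fun a _ =>
      (eventually_cofinite.1 ((hy a).eventually_mem hW)).image _
  refine hfin.subset ?_
  rintro ⟨a, b⟩ hab
  exact mem_biUnion (fun hall => hab (hall b)) ⟨b, hab, rfl⟩

theorem nhds_zero_inf_principal_image_le {𝕜 X L : Type*} [RCLike 𝕜] [AddCommGroup X] [Module 𝕜 X]
    [TopologicalSpace X] [IsTopologicalAddGroup X] [AddCommGroup L] [Module 𝕜 L]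
    [TopologicalSpace L] [T2Space L] (g : X →L[𝕜] L) {C : Set X} (hC : IsCompact C) :
    𝓝 0 ⊓ 𝓟 (g '' C) ≤ stepNhds g := by
  rw [← map_principal, inf_comm, ← Filter.push_pull, map_le_iff_le_comap, le_iff_ultrafilter]
  intro 𝓤 h𝓤
  obtain ⟨c, -, hc⟩ := hC.ultrafilter_le_nhds 𝓤 (h𝓤.trans inf_le_left)
  have hg0 : Tendsto g 𝓤 (𝓝 0) := tendsto_iff_comap.2 (h𝓤.trans inf_le_right)
  have hgc : g c = 0 := tendsto_nhds_unique ((g.continuous.tendsto c).mono_left hc) hg0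
  have hgadd : ⇑g ∘ (c + ·) = g := funext fun x => by
    rw [Function.comp_apply, map_add, hgc, zero_add]
  calc (𝓤 : Filter X) ≤ 𝓝 c := hc
    _ = map (c + ·) (𝓝 0) := (map_add_left_nhds_zero c).symm
    _ ≤ comap g (stepNhds g) := by
      rw [← map_le_iff_le_comap, Filter.map_map, hgadd, stepNhds]

end Sequences

namespace LCLimit

variable {𝕜 : Type*} [RCLike 𝕜] {ι : Type*} [LinearOrder ι] [Countable ι] {G : ι → Type*}
  [∀ k, AddCommGroup (G k)] [∀ k, Module 𝕜 (G k)]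

section Acyclic

variable [∀ k, TopologicalSpace (G k)] {f : ∀ k l, k ≤ l → G k →L[𝕜] G l}

theorem exists_inf_principal_stepNhds_le [∀ k, IsTopologicalAddGroup (G k)]
    [∀ k, FirstCountableTopology (G k)] [T2Space (LCLimit f)] (hreg : IsCompactlyRegular f)
    (k : ι) :
    ∃ m, ∃ U ∈ stepNhds (of f k), ∀ l, stepNhds (of f l) ⊓ 𝓟 U ≤ stepNhds (of f m) := by
  by_contra! hnot
  have : Nonempty ι := ⟨k⟩
  have hcg : ∀ l, (stepNhds (of f l)).IsCountablyGenerated := fun l =>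
    Filter.map.isCountablyGenerated _ _
  obtain ⟨U, hU⟩ := (stepNhds (of f k)).exists_antitone_basis
  obtain ⟨e, he⟩ := exists_surjective_nat ι
  choose l hl using fun n => hnot (e n) (U n) (hU.mem n)
  choose y hyl hyU hye using fun n => exists_seq_tendsto_not_tendsto (hl n)
  have hy0 : ∀ n, Tendsto (y n) atTop (𝓝 0) := fun n =>
    (hyl n).mono_right (stepNhds_le_nhds_zero _)
  have hunif : ∀ W ∈ 𝓝 0, ∀ᶠ n in atTop, ∀ i, y n i ∈ W := fun W hW =>
    (hU.eventually_subset (stepNhds_le_nhds_zero _ hW)).mono fun n hn i => hn (hyU n i)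
  have hcof : Tendsto (Function.uncurry y) cofinite (𝓝 0) := by
    rw [← Nat.cofinite_eq_atTop] at hy0 hunif
    exact tendsto_uncurry_cofinite hy0 hunif
  obtain ⟨m, C, hC, hCK⟩ := hreg _ hcof.isCompact_insert_range_of_cofinite
  obtain ⟨n, rfl⟩ := he m
  refine hye n ((tendsto_inf.2 ⟨hy0 n, tendsto_principal.2 ?_⟩).mono_right
    (nhds_zero_inf_principal_image_le _ hC))
  rw [hCK]
  exact .of_forall fun i => mem_insert_of_mem _ (mem_range_self (n, i))

end Acyclic

theorem completeSpace_of_isCompactlyRegular [∀ k, UniformSpace (G k)] [∀ k, IsUniformAddGroup (G k)]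
    [∀ k, PolynormableSpace 𝕜 (G k)] [∀ k, FirstCountableTopology (G k)] [∀ k, T2Space (G k)]
    [∀ k, CompleteSpace (G k)] [Nonempty ι] {f : ∀ k l, k ≤ l → G k →L[𝕜] G l}
    [DirectedSystem G fun k l h => f k l h] (hreg : IsCompactlyRegular f) :
    CompleteSpace (LCLimit f) := by
  have : ∀ k, ContinuousSMul 𝕜 (G k) := fun k =>
    (PolynormableSpace.withSeminorms 𝕜 (G k)).continuousSMul
  have := t2Space_of_isCompactlyRegular hreg
  choose M U hU hM using exists_inf_principal_stepNhds_le hreg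
  obtain ⟨φ, hφ, hMφ, hcof⟩ := exists_monotone_cofinal_seq M
  exact (isSeqLimit hφ hcof).completeSpace fun n => ⟨U (φ n), hU (φ n), fun m =>
    (hM (φ n) (φ m)).trans (stepNhds_of_mono f (hMφ n))⟩

end LCLimit

section Bilinear

theorem tendsto_nhds_zero_of_forall_seminorm {𝕜 α Y : Type*} [RCLike 𝕜] [AddCommGroup Y]
    [Module 𝕜 Y] [TopologicalSpace Y] [PolynormableSpace 𝕜 Y] {l : Filter α} {u : α → Y}
    (h : ∀ p : Seminorm 𝕜 Y, Continuous p → Tendsto (fun a => p (u a)) l (𝓝 0)) :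
    Tendsto u l (𝓝 0) :=
  ((PolynormableSpace.withSeminorms 𝕜 Y).tendsto_nhds u 0).2 fun p ε hε => by
    simpa only [sub_zero] using (h p p.2).eventually_lt_const hε

variable {𝕜 E F Y : Type*} [RCLike 𝕜] [AddCommGroup E] [Module 𝕜 E] [AddCommGroup F] [Module 𝕜 F]
  [TopologicalSpace E] [TopologicalSpace F] [AddCommGroup Y] [Module 𝕜 Y] [TopologicalSpace Y]

theorem tendsto_nhds_zero_of_separatelyContinuous [FirstCountableTopology E]
    [FirstCountableTopology F] [BarrelledSpace 𝕜 F] [PolynormableSpace 𝕜 Y]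
    (B : E →ₗ[𝕜] F →ₗ[𝕜] Y) (hl : ∀ x, Continuous (B x)) (hr : ∀ y, Continuous fun x => B x y) :
    Tendsto (fun z : E × F => B z.1 z.2) (𝓝 0 ×ˢ 𝓝 0) (𝓝 0) := by
  refine tendsto_of_seq_tendsto fun z hz =>
    tendsto_nhds_zero_of_forall_seminorm (𝕜 := 𝕜) fun p hp => ?_
  have hx : Tendsto (fun n => (z n).1) atTop (𝓝 0) := tendsto_fst.comp hz
  have hy : Tendsto (fun n => (z n).2) atTop (𝓝 0) := tendsto_snd.comp hz
  let σ : ℕ → Seminorm 𝕜 F := fun n => p.comp (B (z n).1)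
  have hbdd : BddAbove (range σ) := Seminorm.bddAbove_range_iff.2 fun y =>
    (((hp.comp (hr y)).tendsto 0).comp hx).bddAbove_range
  have hσ : Continuous (⨆ n, σ n : Seminorm 𝕜 F) := by
    rw [Seminorm.coe_iSup_eq hbdd]
    exact Seminorm.continuous_iSup σ (fun n => hp.comp (hl _)) hbdd
  exact squeeze_zero (fun n => apply_nonneg p _) (fun n => le_ciSup hbdd n (z n).2)
    ((hσ.tendsto' 0 0 (map_zero _)).comp hy)

end Bilinear

namespace InductiveTensor

variable {𝕜 E F : Type*} [RCLike 𝕜] [AddCommGroup E] [Module 𝕜 E] [AddCommGroup F] [Module 𝕜 F]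

theorem induction_on {p : InductiveTensor 𝕜 E F → Prop} (z : InductiveTensor 𝕜 E F) (zero : p 0)
    (tmul : ∀ x y, p (tmul 𝕜 x y)) (add : ∀ z z', p z → p z' → p (z + z')) : p z :=
  TensorProduct.induction_on z zero tmul add

variable (𝕜 E F) in
/-- The canonical bilinear map `(x, y) ↦ x ⊗ y`, bundled. -/
def mk : E →ₗ[𝕜] F →ₗ[𝕜] InductiveTensor 𝕜 E F :=
  TensorProduct.mk 𝕜 E F

theorem mk_apply (x : E) (y : F) : mk 𝕜 E F x y = tmul 𝕜 x y :=
  rfl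

theorem smul_tmul (a : 𝕜) (x : E) (y : F) : tmul 𝕜 (a • x) y = a • tmul 𝕜 x y :=
  (mk 𝕜 E F).map_smul₂ a x y

theorem smul_tmul_inv_smul {a : 𝕜} (ha : a ≠ 0) (x : E) (y : F) :
    tmul 𝕜 (a • x) (a⁻¹ • y) = tmul 𝕜 x y := by
  rw [smul_tmul]
  exact (congrArg (a • ·) (map_smul (mk 𝕜 E F x) a⁻¹ y)).trans (smul_inv_smul₀ ha _)

theorem absorbent_of_tmul_mem_nhds [TopologicalSpace E] [ContinuousSMul 𝕜 E]
    {A : Set (InductiveTensor 𝕜 E F)} (hA : AbsConvex 𝕜 A)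
    (h : ∀ y, ∀ᶠ x in 𝓝 0, tmul 𝕜 x y ∈ A) : Absorbent 𝕜 A := by
  suffices hsmul : ∀ z, ∀ᶠ c : 𝕜 in 𝓝 0, c • z ∈ A from
    absorbent_iff_eventually_nhdsNE_zero.2 fun z => nhdsWithin_le_nhds (hsmul z)
  intro z
  induction z using induction_on with
  | zero =>
    have h0 : (0 : InductiveTensor 𝕜 E F) ∈ A := by
      simpa only [← mk_apply, map_zero] using (h 0).self_of_nhds
    simpa only [smul_zero, eventually_const] using h0
  | tmul x y =>
    have hc : Tendsto (fun c : 𝕜 => c • x) (𝓝 0) (𝓝 0) :=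
      (continuous_id.smul continuous_const).tendsto' 0 0 (zero_smul 𝕜 x)
    simpa only [smul_tmul] using hc.eventually (h y)
  | add z z' hz hz' =>
    have h2 : Tendsto (fun c : 𝕜 => 2 * c) (𝓝 0) (𝓝 0) :=
      (continuous_const_mul 2).tendsto' 0 0 (mul_zero 2)
    filter_upwards [h2.eventually hz, h2.eventually hz'] with c hc hc'
    have hmid : (2⁻¹ : 𝕜) • (2 * c) • z + (2⁻¹ : 𝕜) • (2 * c) • z' ∈ A :=
      hA.2 hc hc' (by positivity) (by positivity) (by norm_num)
    simpa [smul_smul] using hmid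

variable [TopologicalSpace E] [TopologicalSpace F]

theorem continuous_tmul_left (x : E) : Continuous fun y : F => tmul 𝕜 x y :=
  continuous_sInf_rng.2 fun _ ht => ht.2.1 x

theorem continuous_tmul_right (y : F) : Continuous fun x : E => tmul 𝕜 x y :=
  continuous_sInf_rng.2 fun _ ht => ht.2.2 y

theorem continuous_linearMap {Y : Type*} [AddCommGroup Y] [Module 𝕜 Y] [TopologicalSpace Y]
    [PolynormableSpace 𝕜 Y] (T : InductiveTensor 𝕜 E F →ₗ[𝕜] Y)
    (hl : ∀ x, Continuous fun y => T (tmul 𝕜 x y)) (hr : ∀ y, Continuous fun x => T (tmul 𝕜 x y)) :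
    Continuous T :=
  continuous_iff_le_induced.2 <| sInf_le ⟨PolynormableSpace.induced T,
    fun x => continuous_induced_rng.2 (hl x), fun y => continuous_induced_rng.2 (hr y)⟩

section Neighbourhoods

variable [IsTopologicalAddGroup E] [ContinuousSMul 𝕜 E] [IsTopologicalAddGroup F]
  [ContinuousSMul 𝕜 F]

theorem mem_nhds_zero {A : Set (InductiveTensor 𝕜 E F)} (hA : AbsConvex 𝕜 A)
    (hl : ∀ x, ∀ᶠ y in 𝓝 0, tmul 𝕜 x y ∈ A) (hr : ∀ y, ∀ᶠ x in 𝓝 0, tmul 𝕜 x y ∈ A) : A ∈ 𝓝 0 := by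
  obtain ⟨p, hpA, hAp⟩ := exists_seminorm_of_absConvex hA (absorbent_of_tmul_mem_nhds hA hr)
  have hle : (inferInstance : TopologicalSpace (InductiveTensor 𝕜 E F)) ≤ seminormTopology p :=
    sInf_le ⟨polynormableSpace_seminormTopology p,
      fun x => continuous_seminormTopology p (mk 𝕜 E F x) ((hl x).mono fun _ hy => hAp hy),
      fun y => continuous_seminormTopology p ((mk 𝕜 E F).flip y) ((hr y).mono fun _ hx => hAp hx)⟩
  exact mem_of_superset (nhds_mono hle (ball_mem_nhds_seminormTopology p)) hpA

theorem absConvexHull_image2_tmul_mem_nhds_zero {U : Set E} {V : Set F} (hU : U ∈ 𝓝 0)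
    (hV : V ∈ 𝓝 0) : absConvexHull 𝕜 (image2 (tmul 𝕜) U V) ∈ 𝓝 0 := by
  refine mem_nhds_zero absConvex_absConvexHull (fun x => ?_) fun y => ?_
  · obtain ⟨c, hc, hcx⟩ := (eventually_mem_nhdsWithin.and
      ((absorbent_nhds_zero (𝕜 := 𝕜) hU).eventually_nhdsNE_zero x)).exists
    have hcV : ∀ᶠ y in 𝓝 (0 : F), c⁻¹ • y ∈ V :=
      ((continuous_const_smul c⁻¹).tendsto' 0 0 (smul_zero _)).eventually hV
    refine hcV.mono fun y hy => subset_absConvexHull ?_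
    rw [← smul_tmul_inv_smul hc]
    exact mem_image2_of_mem hcx hy
  · obtain ⟨c, hc, hcy⟩ := (eventually_mem_nhdsWithin.and
      ((absorbent_nhds_zero (𝕜 := 𝕜) hV).eventually_nhdsNE_zero y)).exists
    have hcU : ∀ᶠ x in 𝓝 (0 : E), c⁻¹ • x ∈ U :=
      ((continuous_const_smul c⁻¹).tendsto' 0 0 (smul_zero _)).eventually hU
    refine hcU.mono fun x hx => subset_absConvexHull ?_
    rw [← smul_tmul_inv_smul (inv_ne_zero hc), inv_inv]
    exact mem_image2_of_mem hx hcy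

variable [FirstCountableTopology E] [FirstCountableTopology F] [BarrelledSpace 𝕜 F]

theorem hasBasis_nhds_zero {ιE ιF : Type*} {pE : ιE → Prop} {pF : ιF → Prop} {U : ιE → Set E}
    {V : ιF → Set F} (hE : (𝓝 0).HasBasis pE U) (hF : (𝓝 0).HasBasis pF V) :
    (𝓝 (0 : InductiveTensor 𝕜 E F)).HasBasis (fun i : ιE × ιF => pE i.1 ∧ pF i.2) fun i =>
      absConvexHull 𝕜 (image2 (tmul 𝕜) (U i.1) (V i.2)) := by
  refine ⟨fun W => ⟨fun hW => ?_, fun ⟨i, hi, hiW⟩ => mem_of_superset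
    (absConvexHull_image2_tmul_mem_nhds_zero (hE.mem_of_mem hi.1) (hF.mem_of_mem hi.2)) hiW⟩⟩
  obtain ⟨A, hA, hAc, hAW⟩ := exists_absConvex_mem_nhds_zero_subset (𝕜 := 𝕜) hW
  have hmk : Tendsto (fun z : E × F => mk 𝕜 E F z.1 z.2) (𝓝 0 ×ˢ 𝓝 0) (𝓝 0) :=
    tendsto_nhds_zero_of_separatelyContinuous _ continuous_tmul_left continuous_tmul_right
  obtain ⟨i, hi, hiA⟩ := (hE.prod hF).mem_iff.1 (hmk hA)
  refine ⟨i, hi, (absConvexHull_min ?_ hAc).trans hAW⟩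
  exact image2_subset_iff.2 fun x hx y hy => hiA (mk_mem_prod hx hy)

instance : FirstCountableTopology (InductiveTensor 𝕜 E F) := by
  obtain ⟨U, hU⟩ := (𝓝 (0 : E)).exists_antitone_basis
  obtain ⟨V, hV⟩ := (𝓝 (0 : F)).exists_antitone_basis
  have := (hasBasis_nhds_zero (𝕜 := 𝕜) hU.1 hV.1).isCountablyGenerated
  have := IsUniformAddGroup.uniformity_countably_generated (α := InductiveTensor 𝕜 E F)
  infer_instance

end Neighbourhoods

end InductiveTensor

section Completion

variable {𝕜 Y : Type*} [RCLike 𝕜] [AddCommGroup Y] [Module 𝕜 Y] [UniformSpace Y]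
  [IsUniformAddGroup Y]

instance [FirstCountableTopology Y] : FirstCountableTopology (Completion Y) := by
  obtain ⟨U, hU⟩ := (𝓝 (0 : Y)).exists_antitone_basis
  have hbasis := hU.1.hasBasis_of_isDenseInducing Completion.isDenseInducing_coe
  rw [Completion.coe_zero] at hbasis
  have := hbasis.isCountablyGenerated
  have := IsUniformAddGroup.uniformity_countably_generated (α := Completion Y)
  infer_instance

variable [UniformContinuousConstSMul 𝕜 Y]

variable (𝕜 Y) in
/-- The canonical map from a topological vector space to its completion. -/
def completionCoe : Y →L[𝕜] Completion Y where
  toFun := (↑)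
  map_add' := Completion.coe_add
  map_smul' := Completion.coe_smul
  cont := Completion.continuous_coe Y

/-- The continuous extension of a continuous seminorm to the completion. -/
def completionSeminorm (p : Seminorm 𝕜 Y) (hp : Continuous p) : Seminorm 𝕜 (Completion Y) :=
  have hpu : UniformContinuous p := Seminorm.uniformContinuous_of_continuousAt_zero hp.continuousAt
  have hext : Continuous (Completion.extension p) := Completion.continuous_extension
  Seminorm.of (Completion.extension p)
    (fun x y => by
      induction x, y using Completion.induction_on₂ with
      | hp => exact isClosed_le (by fun_prop) (by fun_prop)
      | ih x y =>
        simpa only [← Completion.coe_add, Completion.extension_coe hpu] using map_add_le_add p x y)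
    (fun a x => by
      induction x using Completion.induction_on with
      | hp => exact isClosed_eq (hext.comp (continuous_const_smul a)) (hext.const_mul ‖a‖)
      | ih x =>
        rw [← Completion.coe_smul, Completion.extension_coe hpu, Completion.extension_coe hpu,
          map_smul_eq_mul])

variable {p : Seminorm 𝕜 Y}

theorem completionSeminorm_coe (hp : Continuous p) (y : Y) : completionSeminorm p hp y = p y :=
  Completion.extension_coe (Seminorm.uniformContinuous_of_continuousAt_zero hp.continuousAt) y

theorem continuous_completionSeminorm (hp : Continuous p) : Continuous (completionSeminorm p hp) :=
  Completion.continuous_extension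

theorem ball_completionSeminorm_subset (hp : Continuous p) (r : ℝ) :
    (completionSeminorm p hp).ball 0 r ⊆ closure ((↑) '' p.ball 0 r) := by
  intro z hz
  have hopen : IsOpen {z | completionSeminorm p hp z < r} :=
    isOpen_lt (continuous_completionSeminorm hp) continuous_const
  refine closure_mono ?_ (Completion.denseRange_coe.open_subset_closure_inter hopen
    ((Seminorm.mem_ball_zero _).1 hz))
  rintro _ ⟨hy, y, rfl⟩
  exact ⟨y, p.mem_ball_zero.2 (by rwa [← completionSeminorm_coe hp]), rfl⟩

instance [PolynormableSpace 𝕜 Y] : PolynormableSpace 𝕜 (Completion Y) where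
  withSeminorms' := by
    rw [SeminormFamily.withSeminorms_iff_nhds_eq_iInf]
    refine le_antisymm (le_iInf fun p => ?_) fun V hV => ?_
    · rw [← tendsto_iff_comap]
      exact p.2.tendsto' 0 0 (map_zero _)
    · have hbasis := (PolynormableSpace.withSeminorms 𝕜 Y).hasBasis_zero_ball
        |>.hasBasis_of_isDenseInducing Completion.isDenseInducing_coe
      rw [Completion.coe_zero] at hbasis
      obtain ⟨⟨s, r⟩, hr, hV⟩ := hbasis.mem_iff.1 hV
      have hs : Continuous (s.sup Subtype.val : Seminorm 𝕜 Y) :=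
        Seminorm.continuous_finsetSup fun p _ => p.2
      refine mem_iInf_of_mem ⟨_, continuous_completionSeminorm hs⟩
        ⟨Iio r, Iio_mem_nhds hr, fun z hz => hV (ball_completionSeminorm_subset hs r ?_)⟩
      exact (Seminorm.mem_ball_zero _).2 hz

end Completion

namespace CompletedTensor

variable {𝕜 E E' F : Type*} [RCLike 𝕜] [AddCommGroup E] [Module 𝕜 E]
  [AddCommGroup E'] [Module 𝕜 E'] [AddCommGroup F] [Module 𝕜 F]
  [TopologicalSpace E] [TopologicalSpace E'] [TopologicalSpace F]

theorem map_tmul (g : E →L[𝕜] E') (x : E) (y : F) :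
    map F g (tmul 𝕜 x y) = tmul 𝕜 (g x) y :=
  (InductiveTensor.map F g).completion_apply_coe _

theorem ext_tmul {Y : Type*} [AddCommGroup Y] [Module 𝕜 Y] [TopologicalSpace Y] [T2Space Y]
    {S T : CompletedTensor 𝕜 E F →L[𝕜] Y} (h : ∀ x y, S (tmul 𝕜 x y) = T (tmul 𝕜 x y)) : S = T := by
  ext z
  induction z using Completion.induction_on with
  | hp => exact isClosed_eq S.continuous T.continuous
  | ih z =>
    induction z using InductiveTensor.induction_on with
    | zero => rw [Completion.coe_zero, map_zero, map_zero]
    | tmul x y => exact h x y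
    | add z z' hz hz' => rw [Completion.coe_add, map_add, map_add, hz, hz']

theorem map_id : map F (.id 𝕜 E) = .id 𝕜 (CompletedTensor 𝕜 E F) :=
  ext_tmul fun x y => map_tmul _ x y

theorem map_comp {E'' : Type*} [AddCommGroup E''] [Module 𝕜 E''] [TopologicalSpace E'']
    (g' : E' →L[𝕜] E'') (g : E →L[𝕜] E') : map F (g'.comp g) = (map F g').comp (map F g) :=
  ext_tmul fun x y => by
    rw [ContinuousLinearMap.comp_apply, map_tmul, map_tmul, map_tmul,
      ContinuousLinearMap.comp_apply]

theorem continuous_tmul_left (x : E) : Continuous fun y : F => tmul 𝕜 x y :=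
  (Completion.continuous_coe _).comp (InductiveTensor.continuous_tmul_left x)

theorem continuous_tmul_right (y : F) : Continuous fun x : E => tmul 𝕜 x y :=
  (Completion.continuous_coe _).comp (InductiveTensor.continuous_tmul_right y)

end CompletedTensor

section Comparison

variable {𝕜 : Type*} [RCLike 𝕜] {ι : Type*} [LinearOrder ι] {E : ι → Type*}
  [∀ k, AddCommGroup (E k)] [∀ k, Module 𝕜 (E k)] [∀ k, TopologicalSpace (E k)]
  (f : ∀ k l, k ≤ l → E k →L[𝕜] E l) (F : Type*) [AddCommGroup F] [Module 𝕜 F] [TopologicalSpace F]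

theorem tensorSystem_tmul {k l : ι} (h : k ≤ l) (x : E k) (y : F) :
    tensorSystem f F k l h (CompletedTensor.tmul 𝕜 x y) = CompletedTensor.tmul 𝕜 (f k l h x) y :=
  CompletedTensor.map_tmul _ _ _

instance [DirectedSystem E fun k l h => f k l h] :
    DirectedSystem (fun k => CompletedTensor 𝕜 (E k) F) fun k l h => tensorSystem f F k l h where
  map_self k z := by
    have hid : f k k le_rfl = .id 𝕜 (E k) :=
      ContinuousLinearMap.ext fun x => DirectedSystem.map_self (f := fun k l h => f k l h) x
    rw [tensorSystem, hid, CompletedTensor.map_id, ContinuousLinearMap.id_apply]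
  map_map m l k hkl hlm z := by
    have hcomp : (f l m hlm).comp (f k l hkl) = f k m (hkl.trans hlm) :=
      ContinuousLinearMap.ext fun x => DirectedSystem.map_map (f := fun k l h => f k l h) hkl hlm x
    rw [tensorSystem, tensorSystem, tensorSystem, ← hcomp, CompletedTensor.map_comp,
      ContinuousLinearMap.comp_apply]

theorem tensorSystem_compatible {k l : ι} (h : k ≤ l) (z : CompletedTensor 𝕜 (E k) F) :
    CompletedTensor.map F (LCLimit.of f l) (tensorSystem f F k l h z) =
      CompletedTensor.map F (LCLimit.of f k) z := by
  have hcomp : (LCLimit.of f l).comp (f k l h) = LCLimit.of f k :=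
    ContinuousLinearMap.ext fun x => LCLimit.of_map f h x
  rw [← hcomp, CompletedTensor.map_comp]
  rfl

/-- The canonical linear map `ind lim (E k ⊗̂ F) → (ind lim E k) ⊗̂ F`, before its continuity is
known. -/
def tensorLimitLinear : LCLimit (tensorSystem f F) →ₗ[𝕜] CompletedTensor 𝕜 (LCLimit f) F :=
  Module.DirectLimit.lift 𝕜 ι _ _
    (fun k => (CompletedTensor.map F (LCLimit.of f k)).toLinearMap)
    fun _ _ h => tensorSystem_compatible f F h

theorem tensorLimitLinear_of (k : ι) (z : CompletedTensor 𝕜 (E k) F) :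
    tensorLimitLinear f F (LCLimit.of (tensorSystem f F) k z) =
      CompletedTensor.map F (LCLimit.of f k) z :=
  Module.DirectLimit.lift_of (R := 𝕜) (ι := ι) (G := fun k => CompletedTensor 𝕜 (E k) F) _ _ _

/-- The canonical map `ind lim (E k ⊗̂ F) → (ind lim E k) ⊗̂ F`. -/
def tensorLimitMap : LCLimit (tensorSystem f F) →L[𝕜] CompletedTensor 𝕜 (LCLimit f) F where
  toLinearMap := tensorLimitLinear f F
  cont := LCLimit.continuous_linearMap (tensorLimitLinear f F) fun k => by
    simpa only [tensorLimitLinear_of] using (CompletedTensor.map F (LCLimit.of f k)).continuous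

theorem tensorLimitMap_tmul (k : ι) (x : E k) (y : F) :
    tensorLimitMap f F (LCLimit.of (tensorSystem f F) k (CompletedTensor.tmul 𝕜 x y)) =
      CompletedTensor.tmul 𝕜 (LCLimit.of f k x) y :=
  (tensorLimitLinear_of f F k _).trans (CompletedTensor.map_tmul _ _ _)

/-- The bilinear map `(x, y) ↦ x ⊗ y` from `E k × F` to `ind lim (E k ⊗̂ F)`. -/
def stepTensor (k : ι) : E k →ₗ[𝕜] F →ₗ[𝕜] LCLimit (tensorSystem f F) :=
  (InductiveTensor.mk 𝕜 (E k) F).compr₂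
    ((LCLimit.of (tensorSystem f F) k).comp (completionCoe 𝕜 _)).toLinearMap

theorem stepTensor_map {k l : ι} (h : k ≤ l) (x : E k) :
    stepTensor f F l (f k l h x) = stepTensor f F k x :=
  LinearMap.ext fun y => by
    refine Eq.trans ?_ (LCLimit.of_map (tensorSystem f F) h (CompletedTensor.tmul 𝕜 x y))
    rw [tensorSystem_tmul]
    rfl

/-- The canonical linear map `(ind lim E k) ⊗ F → ind lim (E k ⊗̂ F)`, before its continuity is
known. -/
def limitTensorLinear : InductiveTensor 𝕜 (LCLimit f) F →ₗ[𝕜] LCLimit (tensorSystem f F) :=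
  TensorProduct.lift (Module.DirectLimit.lift 𝕜 ι _ _ (stepTensor f F)
    fun _ _ h => stepTensor_map f F h)

theorem limitTensorLinear_tmul (k : ι) (x : E k) (y : F) :
    limitTensorLinear f F (InductiveTensor.tmul 𝕜 (LCLimit.of f k x) y) =
      LCLimit.of (tensorSystem f F) k (CompletedTensor.tmul 𝕜 x y) :=
  (TensorProduct.lift.tmul _ _).trans (DFunLike.congr_fun (Module.DirectLimit.lift_of _ _ _) y)

variable [Nonempty ι]

/-- The canonical map `(ind lim E k) ⊗_ι F → ind lim (E k ⊗̂ F)`. -/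
def limitTensorMap : InductiveTensor 𝕜 (LCLimit f) F →L[𝕜] LCLimit (tensorSystem f F) where
  toLinearMap := limitTensorLinear f F
  cont := by
    refine InductiveTensor.continuous_linearMap _ (fun x => ?_) fun y => ?_
    · obtain ⟨k, x, rfl⟩ := LCLimit.exists_of f x
      refine ((LCLimit.of (tensorSystem f F) k).continuous.comp
        (CompletedTensor.continuous_tmul_left x)).congr fun y => ?_
      exact (limitTensorLinear_tmul f F k x y).symm
    · refine LCLimit.continuous_linearMap
        ((limitTensorLinear f F).comp ((InductiveTensor.mk 𝕜 (LCLimit f) F).flip y)) fun k => ?_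
      refine ((LCLimit.of (tensorSystem f F) k).continuous.comp
        (CompletedTensor.continuous_tmul_right y)).congr fun x => ?_
      exact (limitTensorLinear_tmul f F k x y).symm

variable [CompleteSpace (LCLimit (tensorSystem f F))] [T2Space (LCLimit (tensorSystem f F))]

theorem fromCompletion_limitTensorMap_tmul (k : ι) (x : E k) (y : F) :
    (limitTensorMap f F).fromCompletion (CompletedTensor.tmul 𝕜 (LCLimit.of f k x) y) =
      LCLimit.of (tensorSystem f F) k (CompletedTensor.tmul 𝕜 x y) :=
  ((limitTensorMap f F).fromCompletion_apply_coe _).trans (limitTensorLinear_tmul f F k x y)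

/-- If `ind lim (E k ⊗̂ F)` is complete and Hausdorff, then it is `(ind lim E k) ⊗̂ F`. -/
def tensorLimitEquiv : LCLimit (tensorSystem f F) ≃L[𝕜] CompletedTensor 𝕜 (LCLimit f) F :=
  .equivOfInverse (tensorLimitMap f F) (limitTensorMap f F).fromCompletion
    (fun z => by
      obtain ⟨k, z, rfl⟩ := LCLimit.exists_of _ z
      have hk : ((limitTensorMap f F).fromCompletion.comp (tensorLimitMap f F)).comp
          (LCLimit.of (tensorSystem f F) k) = LCLimit.of (tensorSystem f F) k :=
        CompletedTensor.ext_tmul fun x y => by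
          rw [ContinuousLinearMap.comp_apply, ContinuousLinearMap.comp_apply, tensorLimitMap_tmul,
            fromCompletion_limitTensorMap_tmul]
      exact DFunLike.congr_fun hk z)
    (fun z => by
      have hid : (tensorLimitMap f F).comp (limitTensorMap f F).fromCompletion = .id 𝕜 _ :=
        CompletedTensor.ext_tmul fun x y => by
          obtain ⟨k, x, rfl⟩ := LCLimit.exists_of f x
          rw [ContinuousLinearMap.comp_apply, fromCompletion_limitTensorMap_tmul,
            tensorLimitMap_tmul, ContinuousLinearMap.id_apply]
      exact DFunLike.congr_fun hid z)

end Comparison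

namespace IsFrechetSpace

variable {𝕜 X : Type*} [RCLike 𝕜] [AddCommGroup X] [Module 𝕜 X] [UniformSpace X]

theorem continuousSMul (h : IsFrechetSpace 𝕜 X) : ContinuousSMul 𝕜 X :=
  have := h.locallyConvex
  (PolynormableSpace.withSeminorms 𝕜 X).continuousSMul

theorem firstCountableTopology (h : IsFrechetSpace 𝕜 X) : FirstCountableTopology X :=
  have := h.metrizable
  inferInstance

theorem barrelledSpace (h : IsFrechetSpace 𝕜 X) : BarrelledSpace 𝕜 X := by
  have := h.isUniformAddGroup
  have := h.complete
  have := h.continuousSMul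
  have := h.firstCountableTopology
  have := IsUniformAddGroup.uniformity_countably_generated (α := X)
  infer_instance

end IsFrechetSpace

end

theorem proposition4_general {𝕜 : Type*} [RCLike 𝕜]
    {ι : Type*} [LinearOrder ι] [Countable ι] [Nonempty ι]
    {E : ι → Type*} [∀ k, AddCommGroup (E k)] [∀ k, Module 𝕜 (E k)] [∀ k, TopologicalSpace (E k)]
    [∀ k, IsTopologicalAddGroup (E k)] [∀ k, ContinuousSMul 𝕜 (E k)]
    [∀ k, FirstCountableTopology (E k)]
    (f : ∀ k l, k ≤ l → E k →L[𝕜] E l) [DirectedSystem E fun k l h => f k l h]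
    {F : Type*} [AddCommGroup F] [Module 𝕜 F] [TopologicalSpace F] [IsTopologicalAddGroup F]
    [ContinuousSMul 𝕜 F] [FirstCountableTopology F] [BarrelledSpace 𝕜 F]
    (hreg : IsCompactlyRegular (tensorSystem f F)) :
    ∃ Φ : LCLimit (tensorSystem f F) ≃L[𝕜] CompletedTensor 𝕜 (LCLimit f) F,
      ∀ (k : ι) (x : E k) (y : F),
        Φ (LCLimit.of (tensorSystem f F) k (CompletedTensor.tmul 𝕜 x y)) =
          CompletedTensor.tmul 𝕜 (LCLimit.of f k x) y := by
  have := fun k => (PolynormableSpace.withSeminorms 𝕜 (CompletedTensor 𝕜 (E k) F)).continuousSMul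
  have := LCLimit.t2Space_of_isCompactlyRegular hreg
  have := LCLimit.completeSpace_of_isCompactlyRegular hreg
  exact ⟨tensorLimitEquiv f F, tensorLimitMap_tmul f F⟩

theorem proposition4 {𝕜 : Type*} [RCLike 𝕜]
    {ι : Type*} [LinearOrder ι] [Countable ι] [Nonempty ι]
    {E : ι → Type*} [∀ k, AddCommGroup (E k)] [∀ k, Module 𝕜 (E k)] [∀ k, UniformSpace (E k)]
    (f : ∀ k l, k ≤ l → E k →L[𝕜] E l) (hE : IsLFSystem f)
    {F : Type*} [AddCommGroup F] [Module 𝕜 F] [UniformSpace F] [IsFrechetSpace 𝕜 F]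
    (hreg : IsCompactlyRegular (tensorSystem f F)) :
    ∃ Φ : LCLimit (tensorSystem f F) ≃L[𝕜] CompletedTensor 𝕜 (LCLimit f) F,
      ∀ (k : ι) (x : E k) (y : F),
        Φ (LCLimit.of (tensorSystem f F) k (CompletedTensor.tmul 𝕜 x y)) =
          CompletedTensor.tmul 𝕜 (LCLimit.of f k x) y := by
  have := fun k => (hE.isFrechetSpace k).isUniformAddGroup
  have := fun k => (hE.isFrechetSpace k).continuousSMul
  have := fun k => (hE.isFrechetSpace k).firstCountableTopology
  have : DirectedSystem E fun k l h => f k l h := ⟨hE.map_self, fun _ _ _ => hE.map_map _ _ _⟩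
  have hF : IsFrechetSpace 𝕜 F := inferInstance
  have := hF.isUniformAddGroup
  have := hF.continuousSMul
  have := hF.firstCountableTopology
  have := hF.barrelledSpace
  exact proposition4_general f hreg
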